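/- Let $f:\{0,1,2,\dots\}\to(0,\infty)$ and let $m_1,m_2,\dots$ be a (possibly random) sequence of positive integers, with $s_0=0$ and $s_n=m_1+\dots+m_n$. The general attachment graph sequence $(\mathcal G_n)_{n\ge0}$ is defined, conditionally on a realization of $(m_i)_{i\ge1}$, as follows. $\mathcal G_0$ is a single vertex $v_0$ with no edges. For $n\ge1$, $\mathcal G_n$ is obtained from $\mathcal G_{n-1}$ by adding a vertex $v_n$ and $m_n$ edges directed away from $v_n$, whose other ends are attached one after the other: conditionally on all previous attachments, the other end is attached to $v_i$, $0\le i\le n-1$, with probability $f(\deg v_i)/\sum_{j=0}^{n-1}f(\deg v_j)$, where $\deg$ is the total (in plus out) degree just before this connection is made. For integers $l\ge 0$ put $\Phi_1(l)=\sum_{i=0}^{l-1}\frac1{f(i)}$. Assume that $f$ is non-decreasing, that there is a constant $C_f>0$ with $f(i)\le C_f(i+1)$ for all $i\ge0$, and that $\sum_{i=0}^\infty \frac1{f(i)^2}<\infty$. Suppose that, almost surely, $$\limsup_{n\to\infty}\frac{\Phi_1(m_n)}{\log s_n}\le\frac1{8C_f}.$$ Then a persistent hub emerges almost surely in $(\mathcal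 G_n)_{n\ge0}$: almost surely there is a (random) finite $n_0$ such that one and the same vertex has maximal degree in $\mathcal G_n$ for all $n\ge n_0$. -/

import Mathlib

open MeasureTheory Filter

namespace GenAttach

/-- `Φ_k(l) = ∑_{i=0}^{l-1} 1 / f(i)^k`. -/
noncomputable def Phi (f : ℕ → ℝ) (k l : ℕ) : ℝ :=
  ∑ i ∈ Finset.range l, 1 / f i ^ k

/-- `s_n = m_1 + ⋯ + m_n`, the number of edges once `v_1, …, v_n` have entered.
Attachment sequences are indexed from `1`; the value `m 0` is never used. -/
def edgeTotal (m : ℕ → ℕ) (n : ℕ) : ℕ :=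
  ∑ i ∈ Finset.range n, m (i + 1)

/-- For `k ≥ 1`, the index `n` of the vertex `v_n` from which the `k`-th edge `e_k` emanates:
the `n` with `s_{n-1} < k ≤ s_n`, that is, the least `n` with `k ≤ s_n`. -/
noncomputable def source (m : ℕ → ℕ) (k : ℕ) : ℕ :=
  sInf {n : ℕ | k ≤ edgeTotal m n}

/-- The degree `d_v(l)` (in-degree plus out-degree) of the vertex `v` in the directed multigraph
with edges `e_1, …, e_l`, where `e_k` goes from `source m k` to `T k`. -/
noncomputable def degree (m T : ℕ → ℕ) (v l : ℕ) : ℕ :=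
  ∑ k ∈ Finset.Icc 1 l, ((if source m k = v then 1 else 0) + (if T k = v then 1 else 0))

/-- The probability with which the `k`-th edge is attached to `v`: if the edge emanates from `v_n`,
it is `f(d_v(k-1)) / ∑_{j<n} f(d_j(k-1))` for each of the older vertices `v < n`, and `0` for all
other vertices. -/
noncomputable def attachProb (f : ℕ → ℝ) (m T : ℕ → ℕ) (k v : ℕ) : ℝ :=
  if v < source m k then
    f (degree m T v (k - 1)) / ∑ j ∈ Finset.range (source m k), f (degree m T j (k - 1))
  else 0

/-- The σ-algebra generated by the whole attachment sequence `m_1, m_2, …` and by the endpoints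
`T_1, …, T_k` of the first `k` edges. -/
abbrev history {Ω : Type*} (m T : ℕ → Ω → ℕ) (k : ℕ) : MeasurableSpace Ω :=
  (⨆ i : ℕ, MeasurableSpace.comap (m (i + 1)) ⊤) ⊔
    ⨆ j ∈ Finset.Icc 1 k, MeasurableSpace.comap (T j) ⊤

/-- The random graph sequence with attachment function `f` and (possibly random) attachment
sequence `m_1, m_2, …` of positive integers: given the attachment sequence, the head `T_k` of the
`k`-th edge is chosen, conditionally on the first `k - 1` edges, with probability proportional to
`f(degree)` among the vertices that were present before the tail of that edge. -/
structure IsAttachmentGraph {Ω : Type*} [MeasurableSpace Ω] (μ : Measure Ω)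
    (f : ℕ → ℝ) (m T : ℕ → Ω → ℕ) : Prop where
  measurable_m : ∀ i, 1 ≤ i → Measurable (m i)
  measurable_T : ∀ k, 1 ≤ k → Measurable (T k)
  one_le_m : ∀ i, 1 ≤ i → ∀ ω, 1 ≤ m i ω
  attach : ∀ k, 1 ≤ k → ∀ v : ℕ,
    μ[({ω | T k ω = v}).indicator (fun _ => (1 : ℝ)) | history m T (k - 1)] =ᵐ[μ]
      fun ω => attachProb f (fun i => m i ω) (fun j => T j ω) k v

/-- For one realization: from some `n₀` on, one and the same vertex `v` has maximal degree in the
graph `G_n`, whose vertices are `0, …, n` and whose edges are `e_1, …, e_{s_n}`. -/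
def HasPersistentHub (m T : ℕ → ℕ) : Prop :=
  ∃ n₀ v : ℕ, ∀ n, n₀ ≤ n → v ≤ n ∧
    ∀ j, j ≤ n → degree m T j (edgeTotal m n) ≤ degree m T v (edgeTotal m n)

end GenAttach

/-!
Why a persistent hub emerges. Write `Φ₁ = Phi f 1`. If edge `k + 1` points to `v`
with probability `f (deg v) / S`, then for every `t` the product `∏_{i < deg v} (1 + t / f i)` grows
on average by the factor `1 + t / S`, whatever the degree of `v` is. As `S` is the same for all
vertices, the functionals
`∏_{i < deg u} (1 + t / f i) * ∏_{i < deg v} (1 - t / f i)`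
of two vertices `u`, `v` are martingales (`martingale_pairFunctional`), for real and for imaginary `t`.
Since `∑ 1 / f i ^ 2` converges, they are `exp (t (Φ₁ (deg u) - Φ₁ (deg v)))` up to bounded factors.

* Large real `t` shows that only finitely many vertices ever catch up with `v_0`. As
  `S ≤ C (3 k + 1)`, a one-vertex version of the functional gives
  `Φ₁ (deg v_0) ≥ log k / (3 C) - O(1)` (`ae_log_le_Phi`). A vertex enters with `Φ₁` at most
  `log s_n / (6 C)`, so its functional against `v_0` starts at `O(s_n ^ (-2))` when `t = 24 C`,
  and it must become of order one if the vertex is to catch up. Doob's maximal inequality and the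
  Borel–Cantelli lemma exclude this for all but finitely many vertices
  (`ae_eventually_lateEntry`, `eventually_mem_lateEntry`).

* Imaginary `t = 𝐢 θ` shows that two given degrees are eventually ordered
  (`ae_eventually_le_or`). If they are not, they agree infinitely often and tend to infinity. Where
  they agree, the martingale is real and close to the supremum `R` of its modulus, but its initial
  value is a vanishing fraction of `R` as `θ → ∞`. So, given any finite part of the evolution,
  perpetual changes of order have conditional probability at most `1 / 2`
  (`measureReal_inter_le_diff`), and by Lévy's zero-one law they have probability zero.

Given both facts, the hub is a maximum of the eventual order on a finite set of vertices
(`hasPersistentHub_of_eventually`).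
-/

namespace GenAttach

/-! ### Edge counts, degrees and hubs of a single realization -/

section

lemma edgeTotal_succ (m : ℕ → ℕ) (n : ℕ) : edgeTotal m (n + 1) = edgeTotal m n + m (n + 1) := by
  simp [edgeTotal, Finset.sum_range_succ]

lemma edgeTotal_mono (m : ℕ → ℕ) : Monotone (edgeTotal m) :=
  monotone_nat_of_le_succ fun n => by rw [edgeTotal_succ]; omega

lemma le_edgeTotal {m : ℕ → ℕ} (hm : ∀ i, 1 ≤ i → 1 ≤ m i) (n : ℕ) : n ≤ edgeTotal m n := by
  induction n with
  | zero => simp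
  | succ n ih => have := hm (n + 1) (by omega); rw [edgeTotal_succ]; omega

lemma source_le_iff {m : ℕ → ℕ} (hm : ∀ i, 1 ≤ i → 1 ≤ m i) (k n : ℕ) :
    source m k ≤ n ↔ k ≤ edgeTotal m n := by
  have hne : {n : ℕ | k ≤ edgeTotal m n}.Nonempty := ⟨k, le_edgeTotal hm k⟩
  constructor
  · intro h
    exact (Nat.sInf_mem hne : k ≤ edgeTotal m (source m k)).trans (edgeTotal_mono m h)
  · intro h
    exact Nat.sInf_le h

lemma lt_source_iff {m : ℕ → ℕ} (hm : ∀ i, 1 ≤ i → 1 ≤ m i) (k n : ℕ) :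
    n < source m k ↔ edgeTotal m n < k := by
  rw [← not_le, source_le_iff hm, not_le]

lemma degree_zero (m T : ℕ → ℕ) (v : ℕ) : degree m T v 0 = 0 := by simp [degree]

lemma degree_succ (m T : ℕ → ℕ) (v k : ℕ) :
    degree m T v (k + 1) = degree m T v k +
      ((if source m (k + 1) = v then 1 else 0) + (if T (k + 1) = v then 1 else 0)) := by
  simp only [degree]
  rw [Finset.sum_Icc_succ_top (by omega)]

/-- Once all edges out of `v` have been placed, the degree of `v` grows only through incoming
edges. -/
lemma degree_succ_of_edgeTotal_le {m : ℕ → ℕ} (hm : ∀ i, 1 ≤ i → 1 ≤ m i) (T : ℕ → ℕ) {v k : ℕ}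
    (h : edgeTotal m v ≤ k) :
    degree m T v (k + 1) = degree m T v k + (if T (k + 1) = v then 1 else 0) := by
  have : v < source m (k + 1) := (lt_source_iff hm _ _).2 (by omega)
  rw [degree_succ, if_neg this.ne', zero_add]

lemma degree_mono (m T : ℕ → ℕ) (v : ℕ) : Monotone (degree m T v) :=
  monotone_nat_of_le_succ fun k => by rw [degree_succ]; omega

lemma degree_le (m T : ℕ → ℕ) (v k : ℕ) : degree m T v k ≤ 2 * k := by
  induction k with
  | zero => simp [degree_zero]
  | succ k ih => rw [degree_succ]; split_ifs <;> omega

lemma sum_degree_le (m T : ℕ → ℕ) (N k : ℕ) : ∑ j ∈ Finset.range N, degree m T j k ≤ 2 * k := by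
  simp only [degree]
  rw [Finset.sum_comm]
  calc _ ≤ ∑ _k ∈ Finset.Icc 1 k, 2 := by
        refine Finset.sum_le_sum fun i _ => ?_
        rw [Finset.sum_add_distrib, Finset.sum_ite_eq, Finset.sum_ite_eq]
        split_ifs <;> omega
    _ = 2 * k := by simp [mul_comm]

/-- The normalising sum in the attachment probability of edge `k + 1` is at most `C (3 k + 1)`:
there are at most `k + 1` old vertices, of total degree at most `2 k`. -/
lemma sum_weight_le {f : ℕ → ℝ} {C : ℝ} (hC : 0 < C) (hf_lin : ∀ i : ℕ, f i ≤ C * ((i : ℝ) + 1))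
    {m : ℕ → ℕ} (hm : ∀ i, 1 ≤ i → 1 ≤ m i) (T : ℕ → ℕ) (k : ℕ) :
    ∑ j ∈ Finset.range (source m (k + 1)), f (degree m T j k) ≤ C * (3 * k + 1) := by
  have hs : source m (k + 1) ≤ k + 1 := (source_le_iff hm _ _).2 (le_edgeTotal hm _)
  have hd := sum_degree_le m T (source m (k + 1)) k
  calc _ ≤ ∑ j ∈ Finset.range (source m (k + 1)), C * ((degree m T j k : ℝ) + 1) :=
        Finset.sum_le_sum fun j _ => hf_lin _
    _ = C * (((∑ j ∈ Finset.range (source m (k + 1)), degree m T j k : ℕ) : ℝ)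
          + (source m (k + 1) : ℕ)) := by
        rw [← Finset.mul_sum, Finset.sum_add_distrib]; simp
    _ ≤ C * (3 * k + 1) := by
        refine mul_le_mul_of_nonneg_left ?_ hC.le
        have h1 : ((∑ j ∈ Finset.range (source m (k + 1)), degree m T j k : ℕ) : ℝ) ≤ 2 * k := by
          exact_mod_cast hd
        have h2 : ((source m (k + 1) : ℕ) : ℝ) ≤ k + 1 := by exact_mod_cast hs
        linarith

/-- The degree of `v_n` when it has entered is at most its number `m_n` of outgoing edges (provided
that edges only point to older vertices). -/
lemma degree_edgeTotal_le {m T : ℕ → ℕ} (hm : ∀ i, 1 ≤ i → 1 ≤ m i)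
    (hT : ∀ k, 1 ≤ k → T k < source m k) (n : ℕ) :
    degree m T (n + 1) (edgeTotal m (n + 1)) ≤ m (n + 1) := by
  have h1 : ∀ k ∈ Finset.Icc 1 (edgeTotal m (n + 1)),
      ((if source m k = n + 1 then 1 else 0) + (if T k = n + 1 then 1 else 0) : ℕ)
        ≤ if k ∈ Finset.Ioc (edgeTotal m n) (edgeTotal m (n + 1)) then 1 else 0 := by
    intro k hk
    rw [Finset.mem_Icc] at hk
    have hs := (source_le_iff hm k (n + 1)).2 hk.2
    have hk' := hT k hk.1
    rw [if_neg (show ¬ T k = n + 1 by omega), add_zero]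
    by_cases h : source m k = n + 1
    · rw [if_pos h, if_pos]
      exact Finset.mem_Ioc.2 ⟨(lt_source_iff hm k n).1 (by omega), hk.2⟩
    · rw [if_neg h]; exact Nat.zero_le _
  calc _ ≤ ∑ k ∈ Finset.Icc 1 (edgeTotal m (n + 1)),
        if k ∈ Finset.Ioc (edgeTotal m n) (edgeTotal m (n + 1)) then 1 else 0 :=
        Finset.sum_le_sum h1
    _ ≤ (Finset.Ioc (edgeTotal m n) (edgeTotal m (n + 1))).card := by
        rw [← Finset.card_filter]
        refine Finset.card_le_card fun k hk => (Finset.mem_filter.1 hk).2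
    _ = m (n + 1) := by rw [Nat.card_Ioc, edgeTotal_succ]; omega

/-- Two sequences of naturals such that neither eventually dominates the other, and the
first of which cannot overtake the second without meeting it, agree infinitely often. -/
lemma frequently_eq_of_not_eventually_le {a b : ℕ → ℕ} {k₀ : ℕ}
    (hab : ∀ k, k₀ ≤ k → a k < b k → a (k + 1) ≤ b (k + 1))
    (h1 : ¬ ∀ᶠ k in atTop, a k ≤ b k) (h2 : ¬ ∀ᶠ k in atTop, b k ≤ a k) :
    ∃ᶠ k in atTop, a k = b k := by
  rw [frequently_atTop]
  intro K
  rw [not_eventually, frequently_atTop] at h1 h2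
  obtain ⟨k₁, hk₁, h⟩ := h2 (max K k₀)
  obtain ⟨k₂, hk₂, h'⟩ := h1 k₁
  by_contra! hne
  have key : ∀ k, k₁ ≤ k → a k < b k := by
    intro k hk
    induction k, hk using Nat.le_induction with
    | base => omega
    | succ k hk ih =>
      have := hab k (by omega) ih
      have := hne (k + 1) (by omega)
      omega
  have := key k₂ hk₂
  omega

/-- Of two monotone sequences of naturals such that neither eventually dominates the other, the
first is unbounded. -/
lemma tendsto_atTop_of_not_eventually_le {a b : ℕ → ℕ} (ha : Monotone a) (hb : Monotone b)
    (h1 : ¬ ∀ᶠ k in atTop, a k ≤ b k) (h2 : ¬ ∀ᶠ k in atTop, b k ≤ a k) :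
    Tendsto a atTop atTop := by
  refine tendsto_atTop_atTop_of_monotone ha fun N => ?_
  rw [not_eventually, frequently_atTop] at h1 h2
  induction N with
  | zero => exact ⟨0, Nat.zero_le _⟩
  | succ N ih =>
    obtain ⟨k, hk⟩ := ih
    obtain ⟨k₁, hk₁, h⟩ := h2 k
    obtain ⟨k₂, hk₂, h'⟩ := h1 k₁
    have e1 := ha hk₁
    have e2 := hb hk₂
    exact ⟨k₂, by omega⟩

/-- If degrees are pairwise eventually ordered and almost all vertices always stay below
vertex `0` after they have entered, then there is a persistent hub. -/
lemma hasPersistentHub_of_eventually {m T : ℕ → ℕ} (hm : ∀ i, 1 ≤ i → 1 ≤ m i)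
    (hnew : ∀ᶠ n in atTop, ∀ k, edgeTotal m n ≤ k → degree m T n k < degree m T 0 k)
    (hpair : ∀ u v, (∀ᶠ k in atTop, degree m T u k ≤ degree m T v k) ∨
      ∀ᶠ k in atTop, degree m T v k ≤ degree m T u k) : HasPersistentHub m T := by
  have hmax : ∀ N, ∃ v ≤ N, ∀ᶠ k in atTop, ∀ j ≤ N, degree m T j k ≤ degree m T v k := by
    intro N
    induction N with
    | zero => exact ⟨0, le_rfl, Eventually.of_forall fun k j hj => by simp [Nat.le_zero.1 hj]⟩
    | succ N ih =>
      obtain ⟨v, hv, h⟩ := ih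
      rcases hpair (N + 1) v with h' | h'
      · refine ⟨v, by omega, ?_⟩
        filter_upwards [h, h'] with k hk hk' j hj
        rcases Nat.le_succ_iff.1 hj with hj | rfl
        · exact hk j hj
        · exact hk'
      · refine ⟨N + 1, le_rfl, ?_⟩
        filter_upwards [h, h'] with k hk hk' j hj
        rcases Nat.le_succ_iff.1 hj with hj | rfl
        · exact (hk j hj).trans hk'
        · exact le_rfl
  obtain ⟨N, hN⟩ := eventually_atTop.1 hnew
  obtain ⟨v, hv, h⟩ := hmax N
  obtain ⟨K, hK⟩ := eventually_atTop.1 h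
  refine ⟨max N K, v, fun n hn => ⟨by omega, fun j hj => ?_⟩⟩
  have hn' : K ≤ edgeTotal m n := le_trans (by omega) (le_edgeTotal hm n)
  rcases le_total j N with hjN | hjN
  · exact hK _ hn' j hjN
  · exact (hN j hjN _ (edgeTotal_mono m hj)).le.trans (hK _ hn' 0 (Nat.zero_le _))

end

/-! ### The filtration and the two-vertex martingales -/

section

variable {Ω : Type*} [m0 : MeasurableSpace Ω] {μ : Measure Ω} {f : ℕ → ℝ} {m T : ℕ → Ω → ℕ}

omit m0 in
lemma history_mono (m T : ℕ → Ω → ℕ) : Monotone (history m T) := by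
  intro k l hkl
  refine sup_le_sup le_rfl (iSup₂_le fun j hj => ?_)
  rw [Finset.mem_Icc] at hj
  exact le_iSup₂_of_le j (Finset.mem_Icc.2 ⟨hj.1, hj.2.trans hkl⟩) le_rfl

lemma IsAttachmentGraph.history_le (hG : IsAttachmentGraph μ f m T) (k : ℕ) :
    history m T k ≤ m0 := by
  refine sup_le (iSup_le fun i => (hG.measurable_m (i + 1) (by omega)).comap_le) ?_
  refine iSup₂_le fun j hj => ?_
  rw [Finset.mem_Icc] at hj
  exact (hG.measurable_T j hj.1).comap_le

/-- The filtration of the attachment process, started at edge `k₀`. -/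
def IsAttachmentGraph.filtration (hG : IsAttachmentGraph μ f m T) (k₀ : ℕ) : Filtration ℕ m0 where
  seq j := history m T (k₀ + j)
  mono' _ _ h := history_mono m T (by omega)
  le' _ := hG.history_le _

omit m0 in
lemma measurable_m_history (m T : ℕ → Ω → ℕ) (k i : ℕ) : Measurable[history m T k] (m (i + 1)) :=
  Measurable.mono (comap_measurable _)
    ((le_iSup (fun i => MeasurableSpace.comap (m (i + 1)) ⊤) i).trans le_sup_left) le_rfl

omit m0 in
lemma measurable_T_history (m T : ℕ → Ω → ℕ) {k j : ℕ} (h1 : 1 ≤ j) (hj : j ≤ k) :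
    Measurable[history m T k] (T j) :=
  Measurable.mono (comap_measurable _)
    ((le_iSup₂ (f := fun j (_ : j ∈ Finset.Icc 1 k) => MeasurableSpace.comap (T j) ⊤) j
      (Finset.mem_Icc.2 ⟨h1, hj⟩)).trans le_sup_right) le_rfl

omit m0 in
lemma measurable_edgeTotal (m T : ℕ → Ω → ℕ) (k n : ℕ) :
    Measurable[history m T k] (fun ω => edgeTotal (fun i => m i ω) n) := by
  let _ := history m T k
  exact Finset.measurable_sum _ fun i _ => measurable_m_history m T k i

lemma IsAttachmentGraph.measurable_source (hG : IsAttachmentGraph μ f m T) (k l : ℕ) :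
    Measurable[history m T k] (fun ω => source (fun i => m i ω) l) := by
  have hm := hG.one_le_m
  let _ := history m T k
  refine measurable_of_Iic fun n => ?_
  have : (fun ω => source (fun i => m i ω) l) ⁻¹' Set.Iic n =
      (fun ω => edgeTotal (fun i => m i ω) n) ⁻¹' Set.Ici l := by
    ext ω
    exact source_le_iff (fun i hi => hm i hi ω) l n
  rw [this]
  exact measurable_edgeTotal m T k n measurableSet_Ici

lemma IsAttachmentGraph.measurable_degree (hG : IsAttachmentGraph μ f m T) (v : ℕ) {k l : ℕ}
    (hl : l ≤ k) :
    Measurable[history m T k] (fun ω => degree (fun i => m i ω) (fun i => T i ω) v l) := by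
  have hs := hG.measurable_source k
  let _ := history m T k
  refine Finset.measurable_sum _ fun j hj => ?_
  rw [Finset.mem_Icc] at hj
  refine Measurable.add ?_ ?_
  · exact Measurable.ite (hs j (measurableSet_singleton v))
      measurable_const measurable_const
  · exact Measurable.ite (measurable_T_history m T hj.1 (hj.2.trans hl) (measurableSet_singleton v))
      measurable_const measurable_const

variable [IsProbabilityMeasure μ]

omit [IsProbabilityMeasure μ] in
lemma measurableSet_T (hG : IsAttachmentGraph μ f m T) (k v : ℕ) :
    MeasurableSet {ω | T (k + 1) ω = v} :=
  hG.measurable_T (k + 1) (by omega) (measurableSet_singleton v)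

/-- The one-step conditional expectation of a functional that changes by `α` if the next edge
points to `u` and by `β` if it points to `v`. -/
lemma condExp_step (hG : IsAttachmentGraph μ f m T) (k u v : ℕ) {Y α β : Ω → ℝ} {c : ℝ}
    (hY : StronglyMeasurable[history m T k] Y) (hα : StronglyMeasurable[history m T k] α)
    (hβ : StronglyMeasurable[history m T k] β) (hYc : Integrable Y μ) (hαc : ∀ ω, ‖α ω‖ ≤ c)
    (hβc : ∀ ω, ‖β ω‖ ≤ c) :
    μ[Y + α * {ω | T (k + 1) ω = u}.indicator (fun _ => (1 : ℝ)) +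
      β * {ω | T (k + 1) ω = v}.indicator (fun _ => (1 : ℝ)) | history m T k] =ᵐ[μ] fun ω =>
      Y ω + α ω * attachProb f (fun i => m i ω) (fun j => T j ω) (k + 1) u +
        β ω * attachProb f (fun i => m i ω) (fun j => T j ω) (k + 1) v := by
  have hle := hG.history_le k
  have hint : ∀ w, Integrable ({ω | T (k + 1) ω = w}.indicator (fun _ => (1 : ℝ))) μ := fun w =>
    (integrable_const 1).indicator (measurableSet_T hG k w)
  have hi : ∀ (γ : Ω → ℝ) w, StronglyMeasurable[history m T k] γ → (∀ ω, ‖γ ω‖ ≤ c) →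
      Integrable (γ * {ω | T (k + 1) ω = w}.indicator (fun _ => (1 : ℝ))) μ := fun γ w hγ hγc =>
    (hint w).bdd_mul (hγ.mono hle).aestronglyMeasurable (Eventually.of_forall hγc)
  have e1 := condExp_add (μ := μ) (hYc.add (hi α u hα hαc)) (hi β v hβ hβc) (history m T k)
  have e2 := condExp_add (μ := μ) hYc (hi α u hα hαc) (history m T k)
  have e3 := condExp_mul_of_stronglyMeasurable_left hα (hi α u hα hαc) (hint u)
  have e4 := condExp_mul_of_stronglyMeasurable_left hβ (hi β v hβ hβc) (hint v)
  have e5 := hG.attach (k + 1) (by omega) u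
  have e6 := hG.attach (k + 1) (by omega) v
  have e7 := condExp_of_stronglyMeasurable hle hY hYc
  rw [Nat.add_sub_cancel] at e5 e6
  filter_upwards [e1, e2, e3, e4, e5, e6] with ω h1 h2 h3 h4 h5 h6
  rw [h1, Pi.add_apply, h2, Pi.add_apply, h3, h4, e7, Pi.mul_apply, Pi.mul_apply, h5, h6]

/-- Almost surely every edge points to a vertex that is older than its tail. -/
lemma ae_lt_source (hG : IsAttachmentGraph μ f m T) :
    ∀ᵐ ω ∂μ, ∀ k, 1 ≤ k → T k ω < source (fun i => m i ω) k := by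
  have key : ∀ k v, ∀ᵐ ω ∂μ, T (k + 1) ω = v → v < source (fun i => m i ω) (k + 1) := by
    intro k v
    set A : Set Ω := {ω | source (fun i => m i ω) (k + 1) ≤ v} with hA
    have hAm : MeasurableSet[history m T k] A := hG.measurable_source k (k + 1) measurableSet_Iic
    have hα : StronglyMeasurable[history m T k] (A.indicator fun _ => (1 : ℝ)) :=
      stronglyMeasurable_const.indicator hAm
    have h := condExp_step hG k v v (Y := 0) (β := 0) (c := 1) stronglyMeasurable_zero hα
      stronglyMeasurable_zero (integrable_zero _ _ _)
      (fun ω => by by_cases h : ω ∈ A <;> simp [h]) (by simp)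
    have h0 : (fun ω => (0 : Ω → ℝ) ω + A.indicator (fun _ => (1 : ℝ)) ω *
          attachProb f (fun i => m i ω) (fun j => T j ω) (k + 1) v +
        (0 : Ω → ℝ) ω * attachProb f (fun i => m i ω) (fun j => T j ω) (k + 1) v) = 0 := by
      funext ω
      by_cases h : ω ∈ A
      · have : ¬ v < source (fun i => m i ω) (k + 1) := not_lt.2 h
        simp [attachProb, this]
      · simp [h]
    rw [h0] at h
    have h' : ∫ ω, (A ∩ {ω | T (k + 1) ω = v}).indicator (fun _ => (1 : ℝ)) ω ∂μ = 0 := by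
      rw [← integral_condExp (hG.history_le k), ← integral_zero Ω ℝ (μ := μ)]
      refine integral_congr_ae ?_
      refine EventuallyEq.trans ?_ h
      refine condExp_congr_ae (Eventually.of_forall fun ω => ?_)
      by_cases h1 : ω ∈ A <;> by_cases h2 : T (k + 1) ω = v <;> simp [h1, h2]
    rw [integral_indicator_const _ ((hG.history_le k _ hAm).inter (measurableSet_T hG k v)),
      smul_eq_mul, mul_one, measureReal_eq_zero_iff] at h'
    filter_upwards [measure_eq_zero_iff_ae_notMem.1 h'] with ω hω hT
    by_contra hlt
    exact hω ⟨not_lt.1 hlt, hT⟩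
  filter_upwards [ae_all_iff.2 fun k => ae_all_iff.2 (key k)] with ω hω k hk
  obtain ⟨k, rfl⟩ := Nat.exists_eq_add_of_le' hk
  exact hω k _ rfl

omit m0 in
lemma exists_bound (g : ℕ → ℕ → ℝ) (N : ℕ) : ∃ c, ∀ a ≤ N, ∀ b ≤ N, ‖g a b‖ ≤ c := by
  obtain ⟨c, hc⟩ := ((Set.finite_Iic N).prod (Set.finite_Iic N)).image
    (fun p : ℕ × ℕ => ‖g p.1 p.2‖) |>.bddAbove
  exact ⟨c, fun a ha b hb => hc ⟨(a, b), ⟨ha, hb⟩, rfl⟩⟩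

/-- The process `g (deg u, deg v)`, observed after edge `k₀ + j` and set to zero off the event `B`.
It is a martingale for suitable `g` when `B` is known at edge `k₀`. -/
noncomputable def pairFunctional (m T : ℕ → Ω → ℕ) (u v k₀ : ℕ) (B : Set Ω) (g : ℕ → ℕ → ℝ)
    (j : ℕ) : Ω → ℝ :=
  B.indicator fun ω => g (degree (fun i => m i ω) (fun i => T i ω) u (k₀ + j))
    (degree (fun i => m i ω) (fun i => T i ω) v (k₀ + j))

omit [IsProbabilityMeasure μ] in
lemma stronglyMeasurable_pairFunctional (hG : IsAttachmentGraph μ f m T) (u v : ℕ) {k₀ : ℕ}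
    {B : Set Ω} (hB : MeasurableSet[history m T k₀] B) (g : ℕ → ℕ → ℝ) (j : ℕ) :
    StronglyMeasurable[history m T (k₀ + j)] (pairFunctional m T u v k₀ B g j) := by
  have hu := hG.measurable_degree u (le_refl (k₀ + j))
  have hv := hG.measurable_degree v (le_refl (k₀ + j))
  let _ := history m T (k₀ + j)
  refine Measurable.stronglyMeasurable ?_
  refine Measurable.indicator ?_ (history_mono m T (by omega) _ hB)
  exact (measurable_of_countable (fun p : ℕ × ℕ => g p.1 p.2)).comp
    (hu.prodMk hv)

omit m0 in
lemma exists_bound_pairFunctional (m T : ℕ → Ω → ℕ) (u v k₀ : ℕ) (B : Set Ω) (g : ℕ → ℕ → ℝ)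
    (j : ℕ) : ∃ c, ∀ ω, ‖pairFunctional m T u v k₀ B g j ω‖ ≤ c := by
  obtain ⟨c, hc⟩ := exists_bound g (2 * (k₀ + j))
  refine ⟨c, fun ω => ?_⟩
  have h := hc _ (degree_le (fun i => m i ω) (fun i => T i ω) u (k₀ + j)) _
    (degree_le (fun i => m i ω) (fun i => T i ω) v (k₀ + j))
  by_cases hω : ω ∈ B
  · simpa [pairFunctional, hω] using h
  · simpa [pairFunctional, hω] using (norm_nonneg _).trans h

lemma integrable_pairFunctional (hG : IsAttachmentGraph μ f m T) (u v : ℕ) {k₀ : ℕ} {B : Set Ω}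
    (hB : MeasurableSet[history m T k₀] B) (g : ℕ → ℕ → ℝ) (j : ℕ) :
    Integrable (pairFunctional m T u v k₀ B g j) μ := by
  obtain ⟨c, hc⟩ := exists_bound_pairFunctional m T u v k₀ B g j
  exact .of_bound ((stronglyMeasurable_pairFunctional hG u v hB g j).mono
    (hG.history_le _)).aestronglyMeasurable c (Eventually.of_forall hc)

/-- If `g` is harmonic for the walk that moves in the two coordinate directions with rates
`f a` and `f b` (on the region `b₀ ≤ b`), then `g (deg u, deg v)` is a martingale once both
vertices have entered: the attachment probabilities to `u` and `v` are `f (deg u)` and `f (deg v)`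
divided by a common normalisation. -/
lemma martingale_pairFunctional (hG : IsAttachmentGraph μ f m T) {u v k₀ b₀ : ℕ} (huv : u ≠ v)
    {B : Set Ω} (hB : MeasurableSet[history m T k₀] B)
    (hBu : ∀ ω ∈ B, edgeTotal (fun i => m i ω) u ≤ k₀)
    (hBv : ∀ ω ∈ B, edgeTotal (fun i => m i ω) v ≤ k₀)
    (hBb : ∀ ω ∈ B, b₀ ≤ degree (fun i => m i ω) (fun i => T i ω) v k₀)
    {g : ℕ → ℕ → ℝ}
    (hg : ∀ a b, b₀ ≤ b → f a * (g (a + 1) b - g a b) + f b * (g a (b + 1) - g a b) = 0) :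
    Martingale (pairFunctional m T u v k₀ B g) (hG.filtration k₀) μ := by
  refine martingale_nat (fun j => stronglyMeasurable_pairFunctional hG u v hB g j)
    (fun j => integrable_pairFunctional hG u v hB g j) fun j => ?_
  set α := pairFunctional m T u v k₀ B (fun a b => g (a + 1) b - g a b) j with hαdef
  set β := pairFunctional m T u v k₀ B (fun a b => g a (b + 1) - g a b) j with hβdef
  obtain ⟨c, hc⟩ := exists_bound_pairFunctional m T u v k₀ B (fun a b => g (a + 1) b - g a b) j
  obtain ⟨c', hc'⟩ := exists_bound_pairFunctional m T u v k₀ B (fun a b => g a (b + 1) - g a b) j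
  have h := condExp_step hG (k₀ + j) u v (c := max c c')
    (stronglyMeasurable_pairFunctional hG u v hB g j)
    (stronglyMeasurable_pairFunctional hG u v hB (fun a b => g (a + 1) b - g a b) j)
    (stronglyMeasurable_pairFunctional hG u v hB (fun a b => g a (b + 1) - g a b) j)
    (integrable_pairFunctional hG u v hB g j) (fun ω => (hc ω).trans (le_max_left _ _))
    (fun ω => (hc' ω).trans (le_max_right _ _))
  have hstep : pairFunctional m T u v k₀ B g (j + 1) = pairFunctional m T u v k₀ B g j +
      α * {ω | T (k₀ + j + 1) ω = u}.indicator (fun _ => (1 : ℝ)) +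
      β * {ω | T (k₀ + j + 1) ω = v}.indicator (fun _ => (1 : ℝ)) := by
    funext ω
    by_cases hω : ω ∈ B
    · have hm : ∀ i, 1 ≤ i → 1 ≤ m i ω := fun i hi => hG.one_le_m i hi ω
      have eu := degree_succ_of_edgeTotal_le hm (fun i => T i ω) (v := u) (k := k₀ + j)
        ((hBu ω hω).trans (by omega))
      have ev := degree_succ_of_edgeTotal_le hm (fun i => T i ω) (v := v) (k := k₀ + j)
        ((hBv ω hω).trans (by omega))
      simp only [α, β, pairFunctional, Pi.add_apply, Pi.mul_apply, Set.indicator_of_mem hω]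
      rw [← add_assoc, eu, ev]
      by_cases h1 : T (k₀ + j + 1) ω = u
      · have h2 : ¬ T (k₀ + j + 1) ω = v := fun h2 => huv (h1.symm.trans h2)
        simp [h1, huv]
      · by_cases h2 : T (k₀ + j + 1) ω = v
        · simp [h2, huv.symm]
        · simp [h1, h2]
    · simp [α, β, pairFunctional, hω]
  rw [hstep]
  refine EventuallyEq.trans ?_ h.symm
  refine Eventually.of_forall fun ω => ?_
  by_cases hω : ω ∈ B
  · have hm : ∀ i, 1 ≤ i → 1 ≤ m i ω := fun i hi => hG.one_le_m i hi ω
    have hu : u < source (fun i => m i ω) (k₀ + j + 1) :=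
      (lt_source_iff hm _ _).2 (by have := hBu ω hω; omega)
    have hv : v < source (fun i => m i ω) (k₀ + j + 1) :=
      (lt_source_iff hm _ _).2 (by have := hBv ω hω; omega)
    simp only [pairFunctional, Set.indicator_of_mem hω, attachProb, hu, hv, if_true,
      Nat.add_sub_cancel]
    have := hg (degree (fun i => m i ω) (fun i => T i ω) u (k₀ + j))
      (degree (fun i => m i ω) (fun i => T i ω) v (k₀ + j))
      ((hBb ω hω).trans (degree_mono _ _ _ (by omega)))
    generalize (∑ j ∈ Finset.range _, f _ : ℝ) = S
    linear_combination (-1 / S) * this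
  · simp [pairFunctional, hω]

end

/-! ### Growth of the degree of the first vertex -/

section

lemma exp_le_one_sub {x : ℝ} (h1 : x ≤ 1 / 2) :
    Real.exp (-(x + 2 * x ^ 2)) ≤ 1 - x := by
  rw [Real.exp_neg]
  have h2 := Real.add_one_le_exp (x + 2 * x ^ 2)
  refine inv_le_of_inv_le₀ (by linarith) ?_
  refine le_trans ?_ h2
  rw [inv_le_iff_one_le_mul₀ (by linarith)]
  nlinarith [mul_nonneg (sq_nonneg x) (sub_nonneg.2 h1)]

lemma Phi_mono {f : ℕ → ℝ} (hf : ∀ i, 0 < f i) : Monotone (Phi f 1) := by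
  refine monotone_nat_of_le_succ fun l => ?_
  rw [Phi, Phi, Finset.sum_range_succ]
  have := hf l
  have : 0 ≤ 1 / f l ^ 1 := by positivity
  linarith

lemma sum_Ico_eq_Phi_sub (f : ℕ → ℝ) {i₀ d : ℕ} (h : i₀ ≤ d) :
    ∑ i ∈ Finset.Ico i₀ d, 1 / f i = Phi f 1 d - Phi f 1 i₀ := by
  simp [Phi, Finset.sum_Ico_eq_sub _ h]

/-- `∏ (1 - t / f i)` is of the order of `exp (-t Φ₁)`, because `∑ 1 / f i ^ 2` converges. -/
lemma exp_le_prod_one_sub {f : ℕ → ℝ} (hf : ∀ i, 0 < f i)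
    (hPhi2 : Summable (fun i : ℕ => 1 / f i ^ 2)) {t : ℝ} (s : Finset ℕ)
    (hs : ∀ i ∈ s, 2 * t ≤ f i) :
    Real.exp (-(t * ∑ i ∈ s, 1 / f i + 2 * t ^ 2 * ∑' i, 1 / f i ^ 2)) ≤
      ∏ i ∈ s, (1 - t / f i) := by
  calc _ ≤ Real.exp (∑ i ∈ s, (-(t / f i + 2 * (t / f i) ^ 2))) := by
        refine Real.exp_le_exp.2 ?_
        rw [Finset.sum_neg_distrib, neg_le_neg_iff, Finset.sum_add_distrib, Finset.mul_sum]
        have h := hPhi2.sum_le_tsum s (fun i _ => by have := hf i; positivity)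
        have h' : ∑ i ∈ s, 2 * (t / f i) ^ 2 = 2 * t ^ 2 * ∑ i ∈ s, 1 / f i ^ 2 := by
          rw [Finset.mul_sum]; exact Finset.sum_congr rfl fun i _ => by ring
        rw [h']
        have h'' : ∑ i ∈ s, t / f i = ∑ i ∈ s, t * (1 / f i) :=
          Finset.sum_congr rfl fun i _ => by ring
        rw [h'']
        have := mul_le_mul_of_nonneg_left h (show 0 ≤ 2 * t ^ 2 by positivity)
        linarith
    _ ≤ _ := by
        rw [Real.exp_sum]
        refine Finset.prod_le_prod (fun i _ => (Real.exp_pos _).le) fun i hi => ?_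
        refine exp_le_one_sub ?_
        rw [div_le_iff₀ (hf i)]
        linarith [hs i hi]

lemma log_add_one_le_sum (k : ℕ) :
    1 / 3 * Real.log (k + 1) ≤ ∑ l ∈ Finset.range k, 1 / (3 * (l : ℝ) + 1) := by
  have h := log_add_one_le_harmonic k
  rw [harmonic] at h
  push_cast at h
  calc _ ≤ 1 / 3 * ∑ l ∈ Finset.range k, ((l : ℝ) + 1)⁻¹ := by linarith
    _ ≤ _ := by
      rw [Finset.mul_sum]
      refine Finset.sum_le_sum fun l _ => ?_
      rw [← one_div, one_div_mul_one_div]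
      exact one_div_le_one_div_of_le (by positivity) (by linarith)

variable {Ω : Type*} [m0 : MeasurableSpace Ω] {μ : Measure Ω} [IsProbabilityMeasure μ]
  {f : ℕ → ℝ} {m T : ℕ → Ω → ℕ}

/-- A nonnegative supermartingale is almost surely bounded. -/
lemma ae_exists_le_of_supermartingale {Y : ℕ → Ω → ℝ} {ℱ : Filtration ℕ m0}
    (hY : Supermartingale Y ℱ μ) (h0 : ∀ n ω, 0 ≤ Y n ω) :
    ∀ᵐ ω ∂μ, ∃ K, ∀ n, Y n ω ≤ K := by
  have hbdd : ∀ n, eLpNorm ((-Y) n) 1 μ ≤ (∫ ω, Y 0 ω ∂μ).toNNReal := by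
    intro n
    have h1 := hY.setIntegral_le (Nat.zero_le n) (s := Set.univ) MeasurableSet.univ
    simp only [setIntegral_univ] at h1
    rw [Pi.neg_apply, eLpNorm_neg, eLpNorm_one_eq_lintegral_enorm,
      ← ofReal_integral_norm_eq_lintegral_enorm (hY.integrable n)]
    refine ENNReal.ofReal_le_ofReal ?_
    simp_rw [Real.norm_of_nonneg (h0 n _)]
    exact h1
  filter_upwards [hY.neg.ae_tendsto_limitProcess hbdd] with ω hω
  obtain ⟨K, hK⟩ := hω.neg.bddAbove_range
  exact ⟨K, fun n => by simpa using hK ⟨n, rfl⟩⟩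

/-- `Φ₁ (deg v_0)` grows at least logarithmically. The reason: with `t = f 0 / 4` and
`A d = ∏_{i < d} (1 - t / f i)`, of the order of `exp (-t Φ₁ d)`, the process `A (deg v_0)` shrinks
on average by the factor `1 - t / S` in a step with normalising sum `S ≤ C (3 k + 1)`. Multiplied by
the deterministic product `r` below, it is a nonnegative supermartingale. -/
lemma ae_log_le_Phi (hf_pos : ∀ i, 0 < f i) (hf_mono : Monotone f)
    {C : ℝ} (hC : 0 < C) (hf_lin : ∀ i : ℕ, f i ≤ C * ((i : ℝ) + 1))
    (hPhi2 : Summable (fun i : ℕ => 1 / f i ^ 2)) (hG : IsAttachmentGraph μ f m T) :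
    ∀ᵐ ω ∂μ, ∃ K, ∀ k : ℕ, 1 / (3 * C) * Real.log (k + 1) - K ≤
      Phi f 1 (degree (fun i => m i ω) (fun i => T i ω) 0 k) := by
  set t : ℝ := f 0 / 4 with ht
  have hf0 := hf_pos 0
  have ht0 : 0 < t := by positivity
  have htf : ∀ i, 4 * t ≤ f i := fun i => by have := hf_mono (Nat.zero_le i); linarith
  have hCf : f 0 ≤ C := by simpa using hf_lin 0
  set c : ℕ → ℝ := fun l => C * (3 * l + 1) with hc
  have hc0 : ∀ l, 4 * t ≤ c l := fun l => by
    have h : (0 : ℝ) ≤ C * (3 * l) := by positivity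
    simp only [hc, mul_add, mul_one]
    linarith
  have hcpos : ∀ l, 0 < c l := fun l => by linarith [hc0 l]
  have htc : ∀ l, t / c l < 1 := fun l => by rw [div_lt_one (hcpos l)]; linarith [hc0 l]
  set r : ℕ → ℝ := fun k => ∏ l ∈ Finset.range k, (1 - t / c l)⁻¹ with hr
  set A : ℕ → ℝ := fun d => ∏ i ∈ Finset.range d, (1 - t / f i) with hA
  have hA0 : ∀ d, 0 ≤ A d := fun d => Finset.prod_nonneg fun i _ => by
    rw [sub_nonneg, div_le_one (hf_pos i)]; linarith [htf i]
  have hr0 : ∀ k, 0 ≤ r k := fun k => Finset.prod_nonneg fun l _ =>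
    inv_nonneg.2 (by linarith [htc l])
  have hrs : ∀ k, r (k + 1) * (1 - t / c k) = r k := fun k => by
    have : 1 - t / c k ≠ 0 := by linarith [htc k]
    simp only [hr, Finset.prod_range_succ]
    field_simp
  have hAs : ∀ d, A (d + 1) - A d = -(t / f d) * A d := fun d => by
    simp only [hA, Finset.prod_range_succ]; ring
  -- Only the first of the two degrees is used.
  set Y : ℕ → Ω → ℝ := fun k => pairFunctional m T 0 0 0 Set.univ (fun a _ => r k * A a) k with hY
  have hm : ∀ ω, ∀ i, 1 ≤ i → 1 ≤ m i ω := fun ω i hi => hG.one_le_m i hi ω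
  have hsuper : Supermartingale Y (hG.filtration 0) μ := by
    refine supermartingale_nat
      (fun k => stronglyMeasurable_pairFunctional hG 0 0 MeasurableSet.univ _ k)
      (fun k => integrable_pairFunctional hG 0 0 MeasurableSet.univ _ k) fun k => ?_
    obtain ⟨b, hb⟩ := exists_bound_pairFunctional m T 0 0 0 Set.univ
      (fun a _ => r (k + 1) * (A (a + 1) - A a)) k
    have hstep := condExp_step hG (0 + k) 0 0 (c := max b 0)
      (stronglyMeasurable_pairFunctional hG 0 0 MeasurableSet.univ (fun a _ => r (k + 1) * A a) k)
      (stronglyMeasurable_pairFunctional hG 0 0 MeasurableSet.univ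
        (fun a _ => r (k + 1) * (A (a + 1) - A a)) k)
      (stronglyMeasurable_zero)
      (integrable_pairFunctional hG 0 0 MeasurableSet.univ _ k)
      (fun ω => (hb ω).trans (le_max_left _ _)) (by simp)
    have heq : Y (k + 1) = pairFunctional m T 0 0 0 Set.univ (fun a _ => r (k + 1) * A a) k +
        pairFunctional m T 0 0 0 Set.univ (fun a _ => r (k + 1) * (A (a + 1) - A a)) k *
          {ω | T (0 + k + 1) ω = 0}.indicator (fun _ => (1 : ℝ)) +
        0 * {ω | T (0 + k + 1) ω = 0}.indicator (fun _ => (1 : ℝ)) := by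
      funext ω
      have e := degree_succ_of_edgeTotal_le (hm ω) (fun i => T i ω) (v := 0) (k := 0 + k)
        (by simp [edgeTotal])
      simp only [hY, pairFunctional, Set.indicator_univ, Pi.add_apply, Pi.mul_apply]
      rw [← add_assoc, e]
      by_cases h1 : T (0 + k + 1) ω = 0
      · rw [zero_add] at h1
        simp [h1]; ring
      · rw [zero_add] at h1
        simp [h1]
    rw [heq]
    refine hstep.le.trans (Eventually.of_forall fun ω => ?_)
    have h0 : 0 < source (fun i => m i ω) (k + 1) :=
      (lt_source_iff (hm ω) _ _).2 (by simp [edgeTotal])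
    simp only [hY, pairFunctional, Set.indicator_univ, attachProb, zero_add, h0, if_true,
      Nat.add_sub_cancel, Pi.zero_apply, zero_mul, add_zero]
    set d := degree (fun i => m i ω) (fun i => T i ω) 0 k
    have hS : (∑ j ∈ Finset.range (source (fun i => m i ω) (k + 1)),
        f (degree (fun i => m i ω) (fun i => T i ω) j k)) ≤ c k :=
      sum_weight_le hC hf_lin (hm ω) _ k
    have hS0 : 0 < ∑ j ∈ Finset.range (source (fun i => m i ω) (k + 1)),
        f (degree (fun i => m i ω) (fun i => T i ω) j k) :=
      Finset.sum_pos (fun _ _ => hf_pos _) ⟨0, Finset.mem_range.2 h0⟩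
    generalize (∑ j ∈ Finset.range (source (fun i => m i ω) (k + 1)),
        f (degree (fun i => m i ω) (fun i => T i ω) j k)) = S at hS hS0
    have h1 : t / c k ≤ t / S := div_le_div_of_nonneg_left ht0.le hS0 hS
    have hfd := hf_pos d
    calc r (k + 1) * A d + r (k + 1) * (A (d + 1) - A d) * (f d / S)
        = r (k + 1) * A d * (1 - t / S) := by rw [hAs]; field_simp; ring
      _ ≤ r (k + 1) * A d * (1 - t / c k) :=
        mul_le_mul_of_nonneg_left (by linarith) (mul_nonneg (hr0 _) (hA0 _))
      _ = r k * A d := by rw [← hrs k]; ring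
  have hnn : ∀ k ω, 0 ≤ Y k ω := fun k ω => by
    simp only [hY, pairFunctional, Set.indicator_univ]
    exact mul_nonneg (hr0 _) (hA0 _)
  filter_upwards [ae_exists_le_of_supermartingale hsuper hnn] with ω ⟨K, hK⟩
  set P := ∑' i, 1 / f i ^ 2
  refine ⟨(Real.log (max K 1) + 2 * t ^ 2 * P) / t, fun k => ?_⟩
  set d := degree (fun i => m i ω) (fun i => T i ω) 0 k with hd
  have h1 : Real.exp (-(t * Phi f 1 d + 2 * t ^ 2 * P)) ≤ A d := by
    have := exp_le_prod_one_sub hf_pos hPhi2 (t := t) (Finset.range d)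
      (fun i _ => by linarith [htf i])
    simpa [Phi, P, hA] using this
  have h2 : Real.exp (t * (1 / (3 * C) * Real.log (k + 1))) ≤ r k := by
    calc _ ≤ Real.exp (∑ l ∈ Finset.range k, t / c l) := by
          refine Real.exp_le_exp.2 ?_
          have h := log_add_one_le_sum k
          have e : ∑ l ∈ Finset.range k, t / c l =
              t / C * ∑ l ∈ Finset.range k, 1 / (3 * (l : ℝ) + 1) := by
            rw [Finset.mul_sum]
            refine Finset.sum_congr rfl fun l _ => ?_
            simp only [hc]
            field_simp
          rw [e]
          calc t * (1 / (3 * C) * Real.log (k + 1)) = t / C * (1 / 3 * Real.log (k + 1)) := by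
                field_simp
            _ ≤ _ := mul_le_mul_of_nonneg_left h (by positivity)
      _ ≤ r k := by
          rw [Real.exp_sum]
          refine Finset.prod_le_prod (fun _ _ => (Real.exp_pos _).le) fun l _ => ?_
          rw [le_inv_comm₀ (Real.exp_pos _) (by linarith [htc l]), ← Real.exp_neg]
          exact Real.one_sub_le_exp_neg _
  have h3 : Real.exp (t * (1 / (3 * C) * Real.log (k + 1)) - (t * Phi f 1 d + 2 * t ^ 2 * P)) ≤
      max K 1 := by
    calc _ = Real.exp (t * (1 / (3 * C) * Real.log (k + 1))) *
          Real.exp (-(t * Phi f 1 d + 2 * t ^ 2 * P)) := by rw [← Real.exp_add, sub_eq_add_neg]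
      _ ≤ r k * A d := mul_le_mul h2 h1 (Real.exp_pos _).le (hr0 k)
      _ = Y k ω := by simp [hY, pairFunctional, hd]
      _ ≤ _ := (hK k).trans (le_max_left _ _)
  have h4 := (Real.le_log_iff_exp_le (by positivity)).2 h3
  rw [sub_le_iff_le_add, ← sub_le_iff_le_add', le_div_iff₀ ht0]
  linarith

end

/-! ### Vertices that catch up with the first vertex -/

section

variable {Ω : Type*} [m0 : MeasurableSpace Ω] {μ : Measure Ω} [IsProbabilityMeasure μ]
  {f : ℕ → ℝ} {m T : ℕ → Ω → ℕ}

/-- Doob's maximal inequality for the whole trajectory of a nonnegative martingale. -/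
lemma mul_measure_exists_le {Y : ℕ → Ω → ℝ} {ℱ : Filtration ℕ m0} (hY : Martingale Y ℱ μ)
    (h0 : ∀ n ω, 0 ≤ Y n ω) (ε : NNReal) :
    ε * μ {ω | ∃ n, (ε : ℝ) ≤ Y n ω} ≤ ENNReal.ofReal (∫ ω, Y 0 ω ∂μ) := by
  have hU : {ω | ∃ n, (ε : ℝ) ≤ Y n ω} = ⋃ n, {ω | ∃ k ≤ n, (ε : ℝ) ≤ Y k ω} := by
    ext ω
    simp only [Set.mem_ofPred_eq, Set.mem_iUnion]
    exact ⟨fun ⟨n, hn⟩ => ⟨n, n, le_rfl, hn⟩, fun ⟨_, k, _, hk⟩ => ⟨k, hk⟩⟩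
  have hmono : Monotone fun n => {ω | ∃ k ≤ n, (ε : ℝ) ≤ Y k ω} :=
    fun n n' h ω ⟨k, hk, hω⟩ => ⟨k, hk.trans h, hω⟩
  rw [hU, hmono.measure_iUnion, ENNReal.mul_iSup]
  refine iSup_le fun n => ?_
  have h1 := maximal_ineq hY.submartingale (fun n ω => h0 n ω) (ε := ε) n
  have hset : {ω | (ε : ℝ) ≤ (Finset.range (n + 1)).sup' Finset.nonempty_range_add_one
      fun k => Y k ω} = {ω | ∃ k ≤ n, (ε : ℝ) ≤ Y k ω} := by
    ext ω
    simp [Finset.le_sup'_iff]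
  rw [hset] at h1
  refine h1.trans (ENNReal.ofReal_le_ofReal ?_)
  have h2 := hY.setIntegral_eq (Nat.zero_le n) (s := Set.univ) MeasurableSet.univ
  simp only [setIntegral_univ] at h2
  rw [h2]
  exact setIntegral_le_integral (hY.integrable n) (Eventually.of_forall fun ω => h0 n ω)

/-- The exponential functional `∏_{i < a} (1 + t / f i) ∏_{i₀ ≤ i < b} (1 - t / f i)`, of the order
of `exp (t (Φ₁ a - Φ₁ b))`. Starting the second product at an index `i₀` beyond which `f` exceeds
`t` keeps it positive. -/
noncomputable def overtake (f : ℕ → ℝ) (t : ℝ) (i₀ a b : ℕ) : ℝ :=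
  (∏ i ∈ Finset.range a, (1 + t / f i)) * ∏ i ∈ Finset.Ico i₀ b, (1 - t / f i)

lemma overtake_harmonic (hf : ∀ i, 0 < f i) (t : ℝ) {i₀ b : ℕ} (a : ℕ) (hb : i₀ ≤ b) :
    f a * (overtake f t i₀ (a + 1) b - overtake f t i₀ a b) +
      f b * (overtake f t i₀ a (b + 1) - overtake f t i₀ a b) = 0 := by
  have h1 := (hf a).ne'
  have h2 := (hf b).ne'
  simp only [overtake, Finset.prod_range_succ, Finset.prod_Ico_succ_top hb]
  field_simp
  ring

lemma overtake_nonneg (hf : ∀ i, 0 < f i) {t : ℝ} (ht : 0 ≤ t) {i₀ : ℕ}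
    (hi₀ : ∀ i, i₀ ≤ i → 2 * t ≤ f i) (a b : ℕ) : 0 ≤ overtake f t i₀ a b := by
  refine mul_nonneg (Finset.prod_nonneg fun i _ => ?_) (Finset.prod_nonneg fun i hi => ?_)
  · have := div_nonneg ht (hf i).le
    linarith
  · rw [Finset.mem_Ico] at hi
    rw [sub_nonneg, div_le_one (hf i)]
    linarith [hi₀ i hi.1]

/-- On `b ≤ a` the functional is bounded below, since the factors pair up to
`1 - (t / f i) ^ 2`. -/
lemma le_overtake (hf : ∀ i, 0 < f i) (hPhi2 : Summable (fun i : ℕ => 1 / f i ^ 2))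
    {t : ℝ} (ht : 0 ≤ t) {i₀ : ℕ} (hi₀ : ∀ i, i₀ ≤ i → 2 * t ≤ f i) {a b : ℕ}
    (hab : b ≤ a) :
    Real.exp (-(2 * t ^ 2 * ∑' i, 1 / f i ^ 2)) ≤ overtake f t i₀ a b := by
  have hx : ∀ i, 0 ≤ t / f i := fun i => div_nonneg ht (hf i).le
  have hx' : ∀ i ∈ Finset.Ico i₀ b, t / f i ≤ 1 / 2 := fun i hi => by
    rw [Finset.mem_Ico] at hi
    rw [div_le_iff₀ (hf i)]
    linarith [hi₀ i hi.1]
  have hsub : ∏ i ∈ Finset.Ico i₀ b, (1 + t / f i) ≤ ∏ i ∈ Finset.range a, (1 + t / f i) := by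
    refine Finset.prod_le_prod_of_subset_of_one_le (fun i hi => ?_)
      (fun i _ => by linarith [hx i]) (fun i _ _ => by linarith [hx i])
    rw [Finset.mem_Ico] at hi
    exact Finset.mem_range.2 (by omega)
  calc _ ≤ Real.exp (∑ i ∈ Finset.Ico i₀ b, (-(2 * (t / f i) ^ 2))) := by
        refine Real.exp_le_exp.2 ?_
        have h := hPhi2.sum_le_tsum (Finset.Ico i₀ b) (fun i _ => by have := hf i; positivity)
        have h' : ∑ i ∈ Finset.Ico i₀ b, 2 * (t / f i) ^ 2 =
            2 * t ^ 2 * ∑ i ∈ Finset.Ico i₀ b, 1 / f i ^ 2 := by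
          rw [Finset.mul_sum]; exact Finset.sum_congr rfl fun i _ => by ring
        rw [Finset.sum_neg_distrib, neg_le_neg_iff, h']
        exact mul_le_mul_of_nonneg_left h (by positivity)
    _ ≤ ∏ i ∈ Finset.Ico i₀ b, ((1 + t / f i) * (1 - t / f i)) := by
        rw [Real.exp_sum]
        refine Finset.prod_le_prod (fun i _ => (Real.exp_pos _).le) fun i hi => ?_
        have h1 := hx i
        have h2 := hx' i hi
        generalize t / f i = x at h1 h2
        have h3 : x ^ 2 ≤ 1 / 4 := by nlinarith
        have h4 := exp_le_one_sub (x := x ^ 2) (by linarith)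
        refine le_trans (Real.exp_le_exp.2 ?_) (h4.trans_eq (by ring))
        nlinarith [sq_nonneg x]
    _ = (∏ i ∈ Finset.Ico i₀ b, (1 + t / f i)) * ∏ i ∈ Finset.Ico i₀ b, (1 - t / f i) :=
        Finset.prod_mul_distrib
    _ ≤ _ := by
        refine mul_le_mul_of_nonneg_right hsub (Finset.prod_nonneg fun i hi => ?_)
        linarith [hx' i hi]

lemma overtake_le (hf : ∀ i, 0 < f i) {t : ℝ} (ht : 0 ≤ t) {i₀ : ℕ}
    (hi₀ : ∀ i, i₀ ≤ i → 2 * t ≤ f i) (a : ℕ) {b : ℕ} (hb : i₀ ≤ b) :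
    overtake f t i₀ a b ≤ Real.exp (t * (Phi f 1 a - Phi f 1 b + Phi f 1 i₀)) := by
  have h1 : ∏ i ∈ Finset.range a, (1 + t / f i) ≤ Real.exp (t * Phi f 1 a) := by
    rw [Phi, Finset.mul_sum, Real.exp_sum]
    refine Finset.prod_le_prod (fun i _ => ?_) fun i _ => ?_
    · have := div_nonneg ht (hf i).le
      linarith
    · rw [pow_one, mul_one_div, add_comm]
      exact Real.add_one_le_exp _
  have h2 : ∏ i ∈ Finset.Ico i₀ b, (1 - t / f i) ≤ Real.exp (-(t * (Phi f 1 b - Phi f 1 i₀))) := by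
    rw [← sum_Ico_eq_Phi_sub f hb, Finset.mul_sum, ← Finset.sum_neg_distrib, Real.exp_sum]
    refine Finset.prod_le_prod (fun i hi => ?_) fun i _ => ?_
    · rw [Finset.mem_Ico] at hi
      rw [sub_nonneg, div_le_one (hf i)]
      linarith [hi₀ i hi.1]
    · rw [mul_one_div]
      exact Real.one_sub_le_exp_neg _
  calc _ ≤ Real.exp (t * Phi f 1 a) * Real.exp (-(t * (Phi f 1 b - Phi f 1 i₀))) := by
        refine mul_le_mul h1 h2 (Finset.prod_nonneg fun i hi => ?_) (Real.exp_pos _).le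
        rw [Finset.mem_Ico] at hi
        rw [sub_nonneg, div_le_one (hf i)]
        linarith [hi₀ i hi.1]
    _ = _ := by rw [← Real.exp_add]; congr 1; ring

/-- The event that `v_n` has entered after exactly `j` edges, that `v_0` then has degree at least
`i₀`, and that the functional `overtake` is then at most `K / j ^ 2`. -/
def lateEntry (f : ℕ → ℝ) (m T : ℕ → Ω → ℕ) (t : ℝ) (i₀ : ℕ) (K : ℝ) (n j : ℕ) : Set Ω :=
  {ω | edgeTotal (fun i => m i ω) n = j} ∩
    ({ω | i₀ ≤ degree (fun i => m i ω) (fun i => T i ω) 0 j} ∩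
    {ω | overtake f t i₀ (degree (fun i => m i ω) (fun i => T i ω) n j)
      (degree (fun i => m i ω) (fun i => T i ω) 0 j) ≤ K / (j : ℝ) ^ 2})

omit [IsProbabilityMeasure μ] in
lemma measurableSet_lateEntry (hG : IsAttachmentGraph μ f m T) (t : ℝ) (i₀ : ℕ) (K : ℝ) (n j : ℕ) :
    MeasurableSet[history m T j] (lateEntry f m T t i₀ K n j) := by
  have hn := hG.measurable_degree n (le_refl j)
  have h0 := hG.measurable_degree 0 (le_refl j)
  have hs := measurable_edgeTotal m T j n
  let _ := history m T j
  refine (hs (measurableSet_singleton j)).inter ((h0 measurableSet_Ici).inter ?_)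
  exact ((measurable_of_countable (fun p : ℕ × ℕ => overtake f t i₀ p.1 p.2)).comp
    (hn.prodMk h0)) measurableSet_Iic

/-- Almost surely only finitely many vertices enter well below `v_0` and still catch up. Each entry
time `j` is treated separately, since the martingale has to start at a fixed edge. -/
lemma ae_eventually_lateEntry (hf : ∀ i, 0 < f i) (hPhi2 : Summable (fun i : ℕ => 1 / f i ^ 2))
    (hG : IsAttachmentGraph μ f m T) {t : ℝ} (ht : 0 ≤ t) {i₀ : ℕ}
    (hi₀ : ∀ i, i₀ ≤ i → 2 * t ≤ f i) {K : ℝ} (hK : 0 ≤ K) :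
    ∀ᵐ ω ∂μ, ∀ᶠ n in atTop, ∀ j, ω ∈ lateEntry f m T t i₀ K n j → ∀ k, j ≤ k →
      degree (fun i => m i ω) (fun i => T i ω) n k <
        degree (fun i => m i ω) (fun i => T i ω) 0 k := by
  set c : NNReal := ⟨Real.exp (-(2 * t ^ 2 * ∑' i, 1 / f i ^ 2)), (Real.exp_pos _).le⟩ with hc
  have hcpos : 0 < c := Real.exp_pos _
  set D : ℕ → ℕ → Set Ω := fun n j => lateEntry f m T t i₀ K n j ∩ {ω | ∃ k, j ≤ k ∧
    degree (fun i => m i ω) (fun i => T i ω) 0 k ≤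
      degree (fun i => m i ω) (fun i => T i ω) n k} with hD
  have hone : ∀ n, 1 ≤ n → ∀ j, c * μ (D n j) ≤
      ENNReal.ofReal (K / (n : ℝ) ^ 2) * μ {ω | edgeTotal (fun i => m i ω) n = j} := by
    intro n hn j
    have hBm := measurableSet_lateEntry hG t i₀ K n j
    have hmart := martingale_pairFunctional hG (u := n) (v := 0) (k₀ := j) (b₀ := i₀)
      (by omega) hBm (fun ω hω => hω.1.le) (fun ω _ => by simp [edgeTotal])
      (fun ω hω => hω.2.1) (fun a b hb => overtake_harmonic hf t a hb)
    have hmax := mul_measure_exists_le hmart (fun k ω =>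
      Set.indicator_nonneg (fun ω _ => overtake_nonneg hf ht hi₀ _ _) ω) c
    have hsm : MeasurableSet {ω | edgeTotal (fun i => m i ω) n = j} :=
      hG.history_le 0 _ (measurable_edgeTotal m T 0 n (measurableSet_singleton j))
    calc _ ≤ c * μ {ω | ∃ k, (c : ℝ) ≤
          pairFunctional m T n 0 j (lateEntry f m T t i₀ K n j) (overtake f t i₀) k ω} := by
          gcongr
          rintro ω ⟨hω, k, hjk, hk⟩
          refine ⟨k - j, ?_⟩
          simp only [pairFunctional, Set.indicator_of_mem hω, Nat.add_sub_cancel' hjk]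
          exact le_overtake hf hPhi2 ht hi₀ hk
      _ ≤ _ := hmax
      _ ≤ ENNReal.ofReal (∫ ω, {ω | edgeTotal (fun i => m i ω) n = j}.indicator
            (fun _ => K / (n : ℝ) ^ 2) ω ∂μ) := by
          refine ENNReal.ofReal_le_ofReal (integral_mono (hmart.integrable 0)
            ((integrable_const _).indicator hsm) fun ω => ?_)
          by_cases hω : ω ∈ lateEntry f m T t i₀ K n j
          · have h1 : ω ∈ {ω | edgeTotal (fun i => m i ω) n = j} := hω.1
            -- `K / j ^ 2 ≤ K / n ^ 2`, because every vertex brings at least one edge.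
            have hnj : n ≤ j := hω.1 ▸ le_edgeTotal (fun i hi => hG.one_le_m i hi ω) n
            simp only [pairFunctional, Set.indicator_of_mem hω, Set.indicator_of_mem h1, add_zero]
            refine le_trans hω.2.2 ?_
            have : (0 : ℝ) < n := by exact_mod_cast hn
            gcongr
          · rw [pairFunctional, Set.indicator_of_notMem hω]
            exact Set.indicator_nonneg (fun _ _ => by positivity) ω
      _ = _ := by
          rw [integral_indicator_const _ hsm, smul_eq_mul, mul_comm,
            ENNReal.ofReal_mul (by positivity), ofReal_measureReal]
  have hsum : ∀ n, 1 ≤ n → c * μ (⋃ j, D n j) ≤ ENNReal.ofReal (K / (n : ℝ) ^ 2) := by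
    intro n hn
    calc c * μ (⋃ j, D n j) ≤ c * ∑' j, μ (D n j) := by gcongr; exact measure_iUnion_le _
      _ = ∑' j, c * μ (D n j) := ENNReal.tsum_mul_left.symm
      _ ≤ ∑' j, ENNReal.ofReal (K / (n : ℝ) ^ 2) * μ {ω | edgeTotal (fun i => m i ω) n = j} :=
        ENNReal.tsum_le_tsum (hone n hn)
      _ = ENNReal.ofReal (K / (n : ℝ) ^ 2) * ∑' j, μ {ω | edgeTotal (fun i => m i ω) n = j} :=
        ENNReal.tsum_mul_left
      _ ≤ ENNReal.ofReal (K / (n : ℝ) ^ 2) * 1 := by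
        gcongr
        rw [← measure_iUnion]
        · exact prob_le_one
        · intro j j' hjj'
          exact Set.disjoint_left.2 fun ω h h' => hjj' (Eq.trans (Eq.symm h) h')
        · exact fun j => hG.history_le 0 _
            (measurable_edgeTotal m T 0 n (measurableSet_singleton j))
      _ = _ := mul_one _
  have hfin : ∑' n, μ (⋃ j, D (n + 1) j) ≠ ⊤ := by
    have hs' : Summable fun n : ℕ => K / (n : ℝ) ^ 2 := by
      simpa only [mul_one_div] using (Real.summable_one_div_nat_pow.2 one_lt_two).mul_left K
    have hs : Summable fun n : ℕ => K / ((n + 1 : ℕ) : ℝ) ^ 2 :=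
      (summable_nat_add_iff (f := fun n : ℕ => K / (n : ℝ) ^ 2) 1).2 hs'
    have h1 : (c : ENNReal) * ∑' n, μ (⋃ j, D (n + 1) j) ≠ ⊤ := by
      rw [← ENNReal.tsum_mul_left]
      exact ne_top_of_le_ne_top hs.tsum_ofReal_ne_top
        (ENNReal.tsum_le_tsum fun n => hsum (n + 1) (by omega))
    intro h
    rw [h, ENNReal.mul_top (by exact_mod_cast hcpos.ne')] at h1
    exact h1 rfl
  filter_upwards [ae_eventually_notMem hfin] with ω hω
  rw [← map_add_atTop_eq_nat 1, eventually_map]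
  filter_upwards [hω] with n hn j hj k hk
  by_contra! h
  exact hn (Set.mem_iUnion.2 ⟨j, hj, k, hk, h⟩)

end

/-! ### Eventual order of two degrees -/

section

/-- `W(d) = ∏_{i < d} (1 + 𝐢 θ / f i)`, of the order of `exp (𝐢 θ Φ₁ d)`. -/
noncomputable def phase (f : ℕ → ℝ) (θ : ℝ) (d : ℕ) : ℂ :=
  ∏ i ∈ Finset.range d, (1 + ((θ / f i : ℝ) : ℂ) * Complex.I)

/-- The real part of `W(a) * conj W(b)`: up to a bounded factor, `cos (θ (Φ₁ a - Φ₁ b))`. -/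
noncomputable def phasePair (f : ℕ → ℝ) (θ : ℝ) (a b : ℕ) : ℝ :=
  (phase f θ a * (starRingEnd ℂ) (phase f θ b)).re

lemma phase_succ (f : ℕ → ℝ) (θ : ℝ) (d : ℕ) :
    phase f θ (d + 1) = phase f θ d * (1 + ((θ / f d : ℝ) : ℂ) * Complex.I) :=
  Finset.prod_range_succ _ _

lemma phasePair_harmonic {f : ℕ → ℝ} (hf : ∀ i, 0 < f i) (θ : ℝ) (a b : ℕ) :
    f a * (phasePair f θ (a + 1) b - phasePair f θ a b) +
      f b * (phasePair f θ a (b + 1) - phasePair f θ a b) = 0 := by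
  have h1 := (hf a).ne'
  have h2 := (hf b).ne'
  simp only [phasePair, phase_succ]
  generalize phase f θ a = z
  generalize phase f θ b = w
  simp
  field_simp
  ring

lemma norm_sq_phase (f : ℕ → ℝ) (θ : ℝ) (d : ℕ) :
    ‖phase f θ d‖ ^ 2 = ∏ i ∈ Finset.range d, (1 + θ ^ 2 / f i ^ 2) := by
  rw [phase, norm_prod, ← Finset.prod_pow]
  refine Finset.prod_congr rfl fun i _ => ?_
  rw [Complex.sq_norm]
  have := Complex.normSq_add_mul_I 1 (θ / f i)
  rw [Complex.ofReal_one] at this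
  rw [this]
  ring

lemma phasePair_self (f : ℕ → ℝ) (θ : ℝ) (d : ℕ) : phasePair f θ d d = ‖phase f θ d‖ ^ 2 := by
  rw [phasePair, Complex.mul_conj, Complex.ofReal_re, Complex.sq_norm]

lemma abs_phasePair_le (f : ℕ → ℝ) (θ : ℝ) (a b : ℕ) :
    |phasePair f θ a b| ≤ ‖phase f θ a‖ * ‖phase f θ b‖ := by
  refine (Complex.abs_re_le_norm _).trans ?_
  rw [norm_mul, Complex.norm_conj]

lemma norm_sq_phase_mono (f : ℕ → ℝ) (θ : ℝ) : Monotone fun d => ‖phase f θ d‖ ^ 2 := by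
  simp only [norm_sq_phase]
  refine monotone_nat_of_le_succ fun d => ?_
  rw [Finset.prod_range_succ]
  refine le_mul_of_one_le_right (Finset.prod_nonneg fun i _ => by positivity) ?_
  have : 0 ≤ θ ^ 2 / f d ^ 2 := by positivity
  linarith

lemma exists_tendsto_norm_sq_phase {f : ℕ → ℝ} (hPhi2 : Summable (fun i : ℕ => 1 / f i ^ 2))
    (θ : ℝ) : ∃ R : ℝ, Tendsto (fun d => ‖phase f θ d‖ ^ 2) atTop (nhds R) := by
  refine ⟨_, tendsto_atTop_ciSup (norm_sq_phase_mono f θ)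
    ⟨Real.exp (θ ^ 2 * ∑' i, 1 / f i ^ 2), ?_⟩⟩
  rintro _ ⟨d, rfl⟩
  simp only [norm_sq_phase]
  calc _ ≤ ∏ i ∈ Finset.range d, Real.exp (θ ^ 2 * (1 / f i ^ 2)) := by
        refine Finset.prod_le_prod (fun i _ => by positivity) fun i _ => ?_
        rw [mul_one_div, add_comm]
        exact Real.add_one_le_exp _
    _ = Real.exp (θ ^ 2 * ∑ i ∈ Finset.range d, 1 / f i ^ 2) := by
        rw [← Real.exp_sum, Finset.mul_sum]
    _ ≤ _ := by
        refine Real.exp_le_exp.2 (mul_le_mul_of_nonneg_left ?_ (sq_nonneg θ))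
        exact hPhi2.sum_le_tsum _ (fun i _ => by positivity)

variable {Ω : Type*} [m0 : MeasurableSpace Ω] {μ : Measure Ω} [IsProbabilityMeasure μ]
  {f : ℕ → ℝ} {m T : ℕ → Ω → ℕ}

/-- Given the past up to edge `k₀`, two vertices that are already present have equal degrees at
arbitrarily large values with probability at most `1 / 2`. The martingale `phasePair (deg u, deg v)`
tends to the limit `R` of `‖W‖ ^ 2` where that happens and is at least `-R` elsewhere, while its
mean is negligible compared with `R` for large `θ`. -/
lemma measureReal_inter_le_diff (hf : ∀ i, 0 < f i) (hPhi2 : Summable (fun i : ℕ => 1 / f i ^ 2))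
    (hG : IsAttachmentGraph μ f m T) {u v k₀ : ℕ} (huv : u ≠ v)
    {B Z : Set Ω} (hB : MeasurableSet[history m T k₀] B) (hZ : MeasurableSet Z)
    (hBu : ∀ ω ∈ B, edgeTotal (fun i => m i ω) u ≤ k₀)
    (hBv : ∀ ω ∈ B, edgeTotal (fun i => m i ω) v ≤ k₀)
    (hZeq : ∀ ω ∈ Z ∩ B, ∃ᶠ k in atTop, degree (fun i => m i ω) (fun i => T i ω) u k =
      degree (fun i => m i ω) (fun i => T i ω) v k)
    (hZtop : ∀ ω ∈ Z ∩ B,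
      Tendsto (degree (fun i => m i ω) (fun i => T i ω) u) atTop atTop) :
    μ.real (Z ∩ B) ≤ μ.real (B \ Z) := by
  have hBm : MeasurableSet B := hG.history_le _ _ hB
  have key : ∀ θ : ℝ, (μ.real (Z ∩ B) - μ.real (B \ Z)) * (1 + θ ^ 2 / f (2 * k₀) ^ 2) ≤ 1 := by
    intro θ
    obtain ⟨R, hR⟩ := exists_tendsto_norm_sq_phase hPhi2 θ
    have hle : ∀ d, ‖phase f θ d‖ ^ 2 ≤ R := fun d => (norm_sq_phase_mono f θ).ge_of_tendsto hR d
    have hab : ∀ a b N, a ≤ N → b ≤ N → |phasePair f θ a b| ≤ ‖phase f θ N‖ ^ 2 := by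
      intro a b N ha hb
      have h1 := (pow_le_pow_iff_left₀ (norm_nonneg _) (norm_nonneg _) two_ne_zero).1
        (norm_sq_phase_mono f θ ha)
      have h2 := (pow_le_pow_iff_left₀ (norm_nonneg _) (norm_nonneg _) two_ne_zero).1
        (norm_sq_phase_mono f θ hb)
      calc _ ≤ _ := abs_phasePair_le f θ a b
        _ ≤ ‖phase f θ N‖ * ‖phase f θ N‖ :=
          mul_le_mul h1 h2 (norm_nonneg _) (norm_nonneg _)
        _ = _ := (sq _).symm
    have hab' : ∀ a b, |phasePair f θ a b| ≤ R := fun a b =>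
      (hab a b (max a b) (le_max_left _ _) (le_max_right _ _)).trans (hle _)
    set Y := pairFunctional m T u v k₀ B (phasePair f θ) with hY
    have hmart : Martingale Y (hG.filtration k₀) μ := martingale_pairFunctional hG (b₀ := 0) huv hB
      hBu hBv (fun _ _ => Nat.zero_le _) (fun a b _ => phasePair_harmonic hf θ a b)
    have hR0 : 0 ≤ R := (sq_nonneg _).trans (hle 0)
    have hYR : ∀ n ω, ‖Y n ω‖ ≤ R := by
      intro n ω
      by_cases hω : ω ∈ B
      · simpa [hY, pairFunctional, hω] using hab' _ _
      · simpa [hY, pairFunctional, hω] using hR0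
    have hbdd : ∀ n, eLpNorm (Y n) 1 μ ≤ R.toNNReal := fun n => by
      refine (eLpNorm_le_of_ae_bound (Eventually.of_forall (hYR n))).trans_eq ?_
      simp [ENNReal.ofReal]
    obtain ⟨L, hlim⟩ : ∃ L : Ω → ℝ, ∀ᵐ ω ∂μ, Tendsto (fun n => Y n ω) atTop (nhds (L ω)) :=
      ⟨_, hmart.submartingale.ae_tendsto_limitProcess hbdd⟩
    have hint : Tendsto (fun n => ∫ ω, Y n ω ∂μ) atTop (nhds (∫ ω, L ω ∂μ)) :=
      tendsto_integral_of_dominated_convergence (fun _ => R)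
        (fun n => (hmart.integrable n).aestronglyMeasurable) (integrable_const R)
        (fun n => Eventually.of_forall (hYR n)) hlim
    have hconst : ∀ n, ∫ ω, Y n ω ∂μ = ∫ ω, Y 0 ω ∂μ := fun n => by
      have := hmart.setIntegral_eq (Nat.zero_le n) (s := Set.univ) MeasurableSet.univ
      simpa only [setIntegral_univ] using this.symm
    simp only [hconst] at hint
    have hL : ∫ ω, L ω ∂μ = ∫ ω, Y 0 ω ∂μ := tendsto_nhds_unique hint tendsto_const_nhds
    -- The initial mean is bounded by the largest modulus that is reachable by edge `k₀`.
    have hup : ∫ ω, Y 0 ω ∂μ ≤ ‖phase f θ (2 * k₀)‖ ^ 2 := by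
      have : ∫ ω, Y 0 ω ∂μ ≤ ∫ _, ‖phase f θ (2 * k₀)‖ ^ 2 ∂μ := by
        refine integral_mono (hmart.integrable 0) (integrable_const _) fun ω => ?_
        by_cases hω : ω ∈ B
        · simp only [hY, pairFunctional, Set.indicator_of_mem hω, add_zero]
          exact (le_abs_self _).trans (hab _ _ _ (degree_le _ _ _ _) (degree_le _ _ _ _))
        · simp only [hY, pairFunctional, Set.indicator_of_notMem hω]
          positivity
      simpa using this
    have hlow : R * μ.real (Z ∩ B) - R * μ.real (B \ Z) ≤ ∫ ω, L ω ∂μ := by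
      have i1 : Integrable ((Z ∩ B).indicator fun _ => R) μ :=
        (integrable_const R).indicator (hZ.inter hBm)
      have i2 : Integrable ((B \ Z).indicator fun _ => R) μ :=
        (integrable_const R).indicator (hBm.diff hZ)
      have e : ∫ ω, ((Z ∩ B).indicator (fun _ => R) ω - (B \ Z).indicator (fun _ => R) ω) ∂μ =
          R * μ.real (Z ∩ B) - R * μ.real (B \ Z) := by
        rw [integral_sub i1 i2, integral_indicator_const _ (hZ.inter hBm),
          integral_indicator_const _ (hBm.diff hZ), smul_eq_mul, smul_eq_mul, mul_comm R,
          mul_comm R]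
      rw [← e]
      have hLi : Integrable L μ := by
        refine Integrable.of_bound ?_ R ?_
        · exact aestronglyMeasurable_of_tendsto_ae atTop
            (fun n => (hmart.integrable n).aestronglyMeasurable) hlim
        · filter_upwards [hlim] with ω hω
          exact le_of_tendsto hω.norm (Eventually.of_forall fun n => hYR n ω)
      refine integral_mono_ae (i1.sub i2) hLi ?_
      filter_upwards [hlim] with ω hω
      by_cases hωB : ω ∈ B
      · by_cases hωZ : ω ∈ Z
        · have hω' : ω ∈ Z ∩ B := ⟨hωZ, hωB⟩
          have h2 : ω ∉ B \ Z := fun h => h.2 hωZ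
          simp only [Set.indicator_of_mem hω', Set.indicator_of_notMem h2, sub_zero]
          refine le_of_eq ?_
          -- Along the times at which the degrees agree, the martingale equals `‖W‖ ^ 2`.
          have hR' : Tendsto (fun n => ‖phase f θ
              (degree (fun i => m i ω) (fun i => T i ω) u (k₀ + n))‖ ^ 2) atTop (nhds R) := by
            have h3 : Tendsto (fun n => k₀ + n) atTop atTop :=
              tendsto_atTop_mono (fun n => Nat.le_add_left n k₀) tendsto_id
            exact hR.comp ((hZtop ω hω').comp h3)
          have hfr : ∃ᶠ n in atTop, degree (fun i => m i ω) (fun i => T i ω) u (k₀ + n) =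
              degree (fun i => m i ω) (fun i => T i ω) v (k₀ + n) := by
            have h4 := hZeq ω hω'
            rw [← map_add_atTop_eq_nat k₀, frequently_map] at h4
            simpa only [add_comm k₀] using h4
          by_contra hne
          obtain ⟨U, V, hU, hV, hxU, hyV, hUV⟩ := t2_separation hne
          have hev := (hR'.eventually (hU.mem_nhds hxU)).and (hω.eventually (hV.mem_nhds hyV))
          obtain ⟨n, hn, hnU, hnV⟩ := (hfr.and_eventually hev).exists
          refine Set.disjoint_left.1 hUV hnU ?_
          have : Y n ω = ‖phase f θ
              (degree (fun i => m i ω) (fun i => T i ω) u (k₀ + n))‖ ^ 2 := by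
            simp only [hY, pairFunctional, Set.indicator_of_mem hωB]
            rw [← hn, phasePair_self]
          rw [← this]
          exact hnV
        · have h1 : ω ∉ Z ∩ B := fun h => hωZ h.1
          have h2 : ω ∈ B \ Z := ⟨hωB, hωZ⟩
          simp only [Set.indicator_of_notMem h1, Set.indicator_of_mem h2, zero_sub]
          exact ge_of_tendsto hω (Eventually.of_forall fun n => (abs_le.1 (hYR n ω)).1)
      · have h1 : ω ∉ Z ∩ B := fun h => hωB h.2
        have h2 : ω ∉ B \ Z := fun h => hωB h.1
        simp only [Set.indicator_of_notMem h1, Set.indicator_of_notMem h2, sub_zero]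
        exact ge_of_tendsto hω (Eventually.of_forall fun n => by simp [hY, pairFunctional, hωB])
    have hq : 0 < ‖phase f θ (2 * k₀)‖ ^ 2 := by
      rw [norm_sq_phase]
      exact Finset.prod_pos fun i _ => by positivity
    have hqR : ‖phase f θ (2 * k₀)‖ ^ 2 * (1 + θ ^ 2 / f (2 * k₀) ^ 2) ≤ R := by
      have := hle (2 * k₀ + 1)
      rwa [norm_sq_phase, Finset.prod_range_succ, ← norm_sq_phase] at this
    set q := ‖phase f θ (2 * k₀)‖ ^ 2
    set x := μ.real (Z ∩ B) - μ.real (B \ Z) with hx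
    have hxq : R * x ≤ q := by rw [hx, mul_sub]; linarith
    rcases le_total x 0 with hx0 | hx0
    · exact (mul_nonpos_of_nonpos_of_nonneg hx0 (by positivity)).trans zero_le_one
    · have := mul_le_mul_of_nonneg_right hqR hx0
      refine le_of_mul_le_mul_left ?_ hq
      linarith
  by_contra! hlt
  set x := μ.real (Z ∩ B) - μ.real (B \ Z) with hx
  have hx0 : 0 < x := sub_pos.2 hlt
  have hfk := hf (2 * k₀)
  -- With `θ ^ 2 = f (2 * k₀) ^ 2 / x` the estimate reads `x + 1 ≤ 1`.
  have h := key (f (2 * k₀) / Real.sqrt x)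
  rw [div_pow, Real.sq_sqrt hx0.le] at h
  have e : x * (1 + f (2 * k₀) ^ 2 / x / f (2 * k₀) ^ 2) = x + 1 := by field_simp
  linarith

/-- Almost surely the degrees of two vertices are eventually ordered. -/
lemma ae_eventually_le_or (hf : ∀ i, 0 < f i) (hPhi2 : Summable (fun i : ℕ => 1 / f i ^ 2))
    (hG : IsAttachmentGraph μ f m T) {u v : ℕ} (huv : u ≠ v) :
    ∀ᵐ ω ∂μ, (∀ᶠ k in atTop, degree (fun i => m i ω) (fun i => T i ω) u k ≤
        degree (fun i => m i ω) (fun i => T i ω) v k) ∨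
      ∀ᶠ k in atTop, degree (fun i => m i ω) (fun i => T i ω) v k ≤
        degree (fun i => m i ω) (fun i => T i ω) u k := by
  set D : ℕ → ℕ → Ω → ℕ := fun w k ω => degree (fun i => m i ω) (fun i => T i ω) w k with hD
  set Z : Set Ω := {ω | ¬ (∀ᶠ k in atTop, D u k ω ≤ D v k ω) ∧
    ¬ ∀ᶠ k in atTop, D v k ω ≤ D u k ω} with hZdef
  have key : ∀ k₀, μ (Z ∩ {ω | edgeTotal (fun i => m i ω) u ≤ k₀ ∧
      edgeTotal (fun i => m i ω) v ≤ k₀}) = 0 := by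
    intro k₀
    set E : Set Ω := {ω | edgeTotal (fun i => m i ω) u ≤ k₀ ∧
      edgeTotal (fun i => m i ω) v ≤ k₀} with hE
    set ℱ := hG.filtration k₀ with hℱ
    have hEm : ∀ n, MeasurableSet[ℱ n] E := fun n =>
      (measurable_edgeTotal m T _ u measurableSet_Iic).inter
        (measurable_edgeTotal m T _ v measurableSet_Iic)
    have hev : ∀ w w', MeasurableSet[⨆ n, ℱ n] {ω | ∀ᶠ k in atTop, D w k ω ≤ D w' k ω} := by
      intro w w'
      have hD' : ∀ w k, Measurable[⨆ n, ℱ n] (D w k) := fun w k =>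
        (hG.measurable_degree w (Nat.le_add_left k k₀)).mono (le_iSup ℱ k) le_rfl
      have : {ω | ∀ᶠ k in atTop, D w k ω ≤ D w' k ω} =
          ⋃ K, ⋂ k, ⋂ (_ : K ≤ k), {ω | D w k ω ≤ D w' k ω} := by
        ext ω
        simp [eventually_atTop]
      rw [this]
      let _ := ⨆ n, ℱ n
      exact MeasurableSet.iUnion fun K => MeasurableSet.iInter fun k => MeasurableSet.iInter
        fun _ => measurableSet_le (hD' w k) (hD' w' k)
    have hZs : MeasurableSet[⨆ n, ℱ n] Z :=
      MeasurableSet.inter (MeasurableSet.compl (hev u v)) (MeasurableSet.compl (hev v u))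
    have hsup : (⨆ n, ℱ n) ≤ m0 := iSup_le fun n => ℱ.le n
    have hZm : MeasurableSet Z := hsup _ hZs
    have hEm' : MeasurableSet E := ℱ.le 0 _ (hEm 0)
    -- By Lévy's zero-one law these events, known at edge `k₀ + n`, converge to `Z ∩ E`.
    set p : ℕ → Ω → ℝ := fun n => μ[Z.indicator (fun _ => (1 : ℝ)) | ℱ n] with hp
    set B : ℕ → Set Ω := fun n => E ∩ {ω | 1 / 2 < p n ω} with hB
    have hBm : ∀ n, MeasurableSet[ℱ n] (B n) := fun n =>
      MeasurableSet.inter (hEm n) (stronglyMeasurable_condExp.measurable measurableSet_Ioi)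
    have hBm' : ∀ n, MeasurableSet (B n) := fun n => ℱ.le n _ (hBm n)
    have hlevy : ∀ᵐ ω ∂μ, Tendsto (fun n => p n ω) atTop
        (nhds (Z.indicator (fun _ => (1 : ℝ)) ω)) :=
      ((integrable_const 1).indicator hZm).tendsto_ae_condExp
        (stronglyMeasurable_const.indicator hZs)
    have hle : ∀ n, μ.real (Z ∩ B n) ≤ μ.real (B n \ Z) := by
      intro n
      refine measureReal_inter_le_diff hf hPhi2 hG huv (hBm n) hZm
        (fun ω hω => hω.1.1.trans (Nat.le_add_right _ _))
        (fun ω hω => hω.1.2.trans (Nat.le_add_right _ _)) ?_ ?_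
      · rintro ω ⟨hωZ, hωB⟩
        have hm : ∀ i, 1 ≤ i → 1 ≤ m i ω := fun i hi => hG.one_le_m i hi ω
        refine frequently_eq_of_not_eventually_le (k₀ := k₀) (fun k hk hlt => ?_) hωZ.1 hωZ.2
        rw [degree_succ_of_edgeTotal_le hm _ (hωB.1.1.trans hk),
          degree_succ_of_edgeTotal_le hm _ (hωB.1.2.trans hk)]
        split_ifs <;> omega
      · rintro ω ⟨hωZ, hωB⟩
        exact tendsto_atTop_of_not_eventually_le (degree_mono _ _ _) (degree_mono _ _ _)
          hωZ.1 hωZ.2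
    have hevB : ∀ᵐ ω ∂μ, ∀ᶠ n in atTop, ω ∈ B n ↔ ω ∈ Z ∩ E := by
      filter_upwards [hlevy] with ω hω
      by_cases hωZ : ω ∈ Z
      · rw [Set.indicator_of_mem hωZ] at hω
        filter_upwards [hω.eventually (lt_mem_nhds (show (1 / 2 : ℝ) < 1 by norm_num))] with n hn
        exact ⟨fun h => ⟨hωZ, h.1⟩, fun h => ⟨h.2, hn⟩⟩
      · rw [Set.indicator_of_notMem hωZ] at hω
        filter_upwards [hω.eventually (gt_mem_nhds (show (0 : ℝ) < 1 / 2 by norm_num))] with n hn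
        exact ⟨fun h => absurd (lt_trans hn h.2) (lt_irrefl _), fun h => absurd h.1 hωZ⟩
    have t1 : Tendsto (fun n => μ (Z ∩ B n)) atTop (nhds (μ (Z ∩ E))) := by
      refine tendsto_measure_of_ae_tendsto_indicator_of_isFiniteMeasure atTop (hZm.inter hEm')
        (fun n => hZm.inter (hBm' n)) ?_
      filter_upwards [hevB] with ω hω
      filter_upwards [hω] with n hn
      exact ⟨fun h => hn.1 h.2, fun h => ⟨h.1, hn.2 h⟩⟩
    have t2 : Tendsto (fun n => μ (B n \ Z)) atTop (nhds (μ ∅)) := by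
      refine tendsto_measure_of_ae_tendsto_indicator_of_isFiniteMeasure atTop MeasurableSet.empty
        (fun n => (hBm' n).diff hZm) ?_
      filter_upwards [hevB] with ω hω
      filter_upwards [hω] with n hn
      exact ⟨fun h => h.2 (hn.1 h.1).1, fun h => h.elim⟩
    have h := le_of_tendsto_of_tendsto' t1 t2 fun n => by
      have := hle n
      rwa [measureReal_def, measureReal_def,
        ENNReal.toReal_le_toReal (measure_ne_top _ _) (measure_ne_top _ _)] at this
    rw [measure_empty] at h
    exact le_antisymm h bot_le
  filter_upwards [ae_all_iff.2 fun k₀ => measure_eq_zero_iff_ae_notMem.1 (key k₀)] with ω hω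
  by_contra h
  rw [not_or] at h
  exact hω (max (edgeTotal (fun i => m i ω) u) (edgeTotal (fun i => m i ω) v))
    ⟨h, le_max_left _ _, le_max_right _ _⟩

end

/-! ### Assembling the hub -/

section

lemma exists_forall_le_of_summable {f : ℕ → ℝ} (hf : ∀ i, 0 < f i)
    (hPhi2 : Summable (fun i : ℕ => 1 / f i ^ 2)) {t : ℝ} (ht : 0 < t) :
    ∃ i₀, ∀ i, i₀ ≤ i → t ≤ f i := by
  have h := hPhi2.tendsto_atTop_zero.eventually (gt_mem_nhds (show 0 < 1 / t ^ 2 by positivity))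
  obtain ⟨i₀, hi₀⟩ := eventually_atTop.1 h
  refine ⟨i₀, fun i hi => ?_⟩
  have h1 := hi₀ i hi
  rw [one_div_lt_one_div (pow_pos (hf i) 2) (by positivity)] at h1
  exact (lt_of_pow_lt_pow_left₀ 2 (hf i).le h1).le

/-- A vertex `v_n` that enters with `Φ₁ (m_n) ≤ log s_n / (6 C)`, when `Φ₁ (deg v_0)` is at least
`log s_n / (3 C)` up to a constant, enters late in the sense of `lateEntry` (with `t = 24 C`). -/
lemma eventually_mem_lateEntry {Ω : Type*} {f : ℕ → ℝ} {m T : ℕ → Ω → ℕ} {ω : Ω}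
    (hf : ∀ i, 0 < f i) {C : ℝ} (hC : 0 < C) {i₀ : ℕ}
    (hi₀ : ∀ i, i₀ ≤ i → 2 * (24 * C) ≤ f i) (hm : ∀ i, 1 ≤ i → 1 ≤ m i ω)
    (hT : ∀ k, 1 ≤ k → T k ω < source (fun i => m i ω) k) {K : ℝ}
    (hgrow : ∀ k : ℕ, 1 / (3 * C) * Real.log (k + 1) - K ≤
      Phi f 1 (degree (fun i => m i ω) (fun i => T i ω) 0 k))
    (hPhi : ∀ᶠ n in atTop, Phi f 1 (m n ω) /
      Real.log (edgeTotal (fun i => m i ω) n : ℝ) < 1 / (6 * C)) :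
    ∀ᶠ n in atTop, ω ∈ lateEntry f m T (24 * C) i₀ (Real.exp (24 * C * Phi f 1 i₀)) n
      (edgeTotal (fun i => m i ω) n) := by
  have hlog : Tendsto (fun n => Real.log (edgeTotal (fun i => m i ω) n : ℝ)) atTop atTop :=
    Real.tendsto_log_atTop.comp (tendsto_natCast_atTop_atTop.comp
      (tendsto_atTop_mono (le_edgeTotal (m := fun i => m i ω) hm) tendsto_id))
  filter_upwards [hPhi, hlog.eventually_gt_atTop 0, hlog.eventually_ge_atTop (12 * C * K),
    hlog.eventually_gt_atTop (4 * C * Phi f 1 i₀), eventually_ge_atTop 1] with n h1 h2 h3 h4 h5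
  obtain ⟨n, rfl⟩ := Nat.exists_eq_add_of_le' h5
  have hpos : 0 < edgeTotal (fun i => m i ω) (n + 1) := h5.trans (le_edgeTotal hm (n + 1))
  have hdeg := degree_edgeTotal_le (m := fun i => m i ω) (T := fun i => T i ω) hm hT n
  set s := edgeTotal (fun i => m i ω) (n + 1) with hs
  set l := Real.log (s : ℝ) with hl
  set a := degree (fun i => m i ω) (fun i => T i ω) (n + 1) s with ha
  set b := degree (fun i => m i ω) (fun i => T i ω) 0 s with hb
  have hs0 : (0 : ℝ) < s := by exact_mod_cast hpos
  have hg := hgrow s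
  have hll : l ≤ Real.log ((s : ℝ) + 1) := Real.log_le_log hs0 (by linarith)
  have hb1 : l / (4 * C) ≤ Phi f 1 b := by
    have e1 : 1 / (3 * C) * l ≤ 1 / (3 * C) * Real.log ((s : ℝ) + 1) :=
      mul_le_mul_of_nonneg_left hll (by positivity)
    have e2 : K ≤ l / (12 * C) := by rw [le_div_iff₀ (by positivity)]; linarith
    have e3 : l / (4 * C) = 1 / (3 * C) * l - l / (12 * C) := by field_simp; ring
    linarith
  have hb2 : Phi f 1 i₀ < l / (4 * C) := by rw [lt_div_iff₀ (by positivity)]; linarith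
  have hib : i₀ ≤ b := by
    by_contra! h
    have := Phi_mono hf h.le
    linarith
  have ha1 : Phi f 1 a ≤ l / (6 * C) := by
    refine (Phi_mono hf hdeg).trans ?_
    rw [div_lt_iff₀ h2] at h1
    refine h1.le.trans_eq ?_
    ring
  refine ⟨rfl, hib, ?_⟩
  refine (overtake_le hf (by positivity) hi₀ a hib).trans ?_
  have e : Real.exp (24 * C * Phi f 1 i₀) / (s : ℝ) ^ 2 =
      Real.exp (24 * C * Phi f 1 i₀ - 2 * l) := by
    rw [Real.exp_sub, hl, two_mul, Real.exp_add, Real.exp_log hs0, sq]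
  rw [e]
  refine Real.exp_le_exp.2 ?_
  -- The factor `24 C` turns the gap `1 / (4 C) - 1 / (6 C)` into the exponent `2`.
  have e1 : 24 * C * (l / (6 * C) - l / (4 * C)) = -2 * l := by field_simp; ring
  have e2 : 24 * C * (Phi f 1 a - Phi f 1 b) ≤ 24 * C * (l / (6 * C) - l / (4 * C)) :=
    mul_le_mul_of_nonneg_left (by linarith) (by positivity)
  linarith

end

end GenAttach

theorem theorem4p1 {Ω : Type*} [MeasurableSpace Ω] (μ : Measure Ω) [IsProbabilityMeasure μ]
    (f : ℕ → ℝ) (hf_pos : ∀ i, 0 < f i) (hf_mono : Monotone f)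
    (C : ℝ) (hC : 0 < C) (hf_lin : ∀ i : ℕ, f i ≤ C * ((i : ℝ) + 1))
    (hPhi2 : Summable (fun i : ℕ => 1 / f i ^ 2))
    (m T : ℕ → Ω → ℕ) (hG : GenAttach.IsAttachmentGraph μ f m T)
    (hm : ∀ᵐ ω ∂μ,
      limsup (fun n : ℕ =>
        ((GenAttach.Phi f 1 (m n ω) /
          Real.log (GenAttach.edgeTotal (fun i => m i ω) n : ℝ) : ℝ) : EReal)) atTop
        ≤ ((1 / (8 * C) : ℝ) : EReal)) :
    ∀ᵐ ω ∂μ, GenAttach.HasPersistentHub (fun i => m i ω) (fun k => T k ω) := by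
  obtain ⟨i₀, hi₀⟩ := GenAttach.exists_forall_le_of_summable hf_pos hPhi2
    (show 0 < 2 * (24 * C) by positivity)
  have hpair : ∀ u v, ∀ᵐ ω ∂μ,
      (∀ᶠ k in atTop, GenAttach.degree (fun i => m i ω) (fun i => T i ω) u k ≤
        GenAttach.degree (fun i => m i ω) (fun i => T i ω) v k) ∨
      ∀ᶠ k in atTop, GenAttach.degree (fun i => m i ω) (fun i => T i ω) v k ≤
        GenAttach.degree (fun i => m i ω) (fun i => T i ω) u k := fun u v => by
    rcases eq_or_ne u v with rfl | huv
    · exact Eventually.of_forall fun ω => Or.inl (Eventually.of_forall fun k => le_rfl)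
    · exact GenAttach.ae_eventually_le_or hf_pos hPhi2 hG huv
  filter_upwards [ae_all_iff.2 fun u => ae_all_iff.2 (hpair u), hm, GenAttach.ae_lt_source hG,
    GenAttach.ae_log_le_Phi hf_pos hf_mono hC hf_lin hPhi2 hG,
    GenAttach.ae_eventually_lateEntry hf_pos hPhi2 hG (by positivity : 0 ≤ 24 * C) hi₀
      (Real.exp_pos (24 * C * GenAttach.Phi f 1 i₀)).le] with ω hord hlim hT ⟨K, hgrow⟩ hlate
  have hm' : ∀ i, 1 ≤ i → 1 ≤ m i ω := fun i hi => hG.one_le_m i hi ω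
  have hlt : (1 / (8 * C) : ℝ) < 1 / (6 * C) :=
    one_div_lt_one_div_of_lt (by positivity) (by linarith)
  have hPhi := eventually_lt_of_limsup_lt (hlim.trans_lt (EReal.coe_lt_coe_iff.2 hlt))
  simp only [EReal.coe_lt_coe_iff] at hPhi
  refine GenAttach.hasPersistentHub_of_eventually hm' ?_ hord
  filter_upwards [hlate, GenAttach.eventually_mem_lateEntry hf_pos hC hi₀ hm' hT hgrow hPhi]
    with n h1 h2
  exact h1 _ h2
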